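/- Let $0<r<1/2$, $0<2\omega<1-2r$ and $s=\frac{r}{2-4r-2\omega}$. Let $\phi_j$, $j\ge 1$, be a complete orthonormal system in $L_2(0,1)$. One observes $dY_\varepsilon(t)=S(t)\,dt+\varepsilon\,dw(t)$, $t\in(0,1)$, where $dw$ is Gaussian white noise; put $y_{\varepsilon j}=\int_0^1\phi_j\,dY_\varepsilon$ and $$T_\varepsilon=\varepsilon^{-2}\sum_{j\ge1}\varkappa_{\varepsilon j}^2y_{\varepsilon j}^2-\rho_\varepsilon^2,\qquad \rho_\varepsilon^2=\sum_{j\ge1}\varkappa_{\varepsilon j}^2<\infty ,\qquad A_\varepsilon=\varepsilon^{-4}\sum_{j\ge1}\varkappa_{\varepsilon j}^4 .$$ Put $k_\varepsilon=\sup\{k:\sum_{j<k}\varkappa_{\varepsilon j}^2\le\tfrac12\rho_\varepsilon^2\}$, $\varkappa_\varepsilon^2=\varkappa^2_{\varepsilon k_\varepsilon}$, and assume: A1. For each $\varepsilon>0$ the sequence $j\mapsto\varkappa_{\varepsilon j}^2$ is non-increasing. A2. There are constants $0<C_1<C_2$ with $C_1<A_\varepsilon<C_2$ for all $\varepsilon>0$.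 A3. There are $C>0$ and $\lambda>1$ such that $\varkappa^2_{\varepsilon,[(1+\delta)k_\varepsilon]}<C(1+\delta)^{-\lambda}\varkappa_\varepsilon^2$ for all $\delta>0$, $\varepsilon>0$. A4. $\varkappa_{\varepsilon1}^2\asymp\varkappa_\varepsilon^2$ as $\varepsilon\to0$, and for every $c>1$ there is $C>0$ with $\varkappa^2_{\varepsilon,[ck_\varepsilon]}\ge C\varkappa_\varepsilon^2$ for all $\varepsilon>0$. Assume also $k_\varepsilon\asymp\varepsilon^{-4+8r+4\omega}$ as $\varepsilon\to0$. For the tests $L_{\varepsilon}=\mathbf 1\{A_\varepsilon^{-1/2}T_\varepsilon>x_\varepsilon\}$ let $\alpha(L_\varepsilon)=\mathbf E_0L_\varepsilon$ and $\beta(L_\varepsilon,S)=\mathbf E_S(1-L_\varepsilon)$. For $R_\varepsilon\to\infty$, alternatives $S_\varepsilon$ observed at noise level $\varepsilon$ (a family with $\varepsilon\to0$, or a sequence with $\varepsilon=\varepsilon_n\to0$) are called $R_\varepsilon$-LD consistent if, for every choice of the critical values $x_\varepsilon$ with $R_\varepsilon^{-2}\log\alpha(L_\varepsilon)\to0$,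 there is $C$ with $R_\varepsilon^2\le C\,|\log\beta(L_\varepsilon,S_\varepsilon)|$ in the limit (i.e. for all small $\varepsilon$, respectively all large $n$; $|\log0|=\infty$). Otherwise they are called $R_\varepsilon$-LD inconsistent. For $P_0>0$ let $U=\bar{\mathbb B}^s_{2\infty}(P_0)$ be the set of $S=\sum_j\theta_j\phi_j\in L_2(0,1)$ with $\sup_{\lambda>0}\lambda^{2s}\sum_{j>\lambda}\theta_j^2\le P_0$, and let $\Xi=\bar{\mathbb B}^s_{2\infty}$ be the set of those for which this supremum is finite. Then, for every $P_0>0$, $U$ is a maxiset and $\Xi$ a maxispace for the statistics $T_\varepsilon$. That is: $U$ is convex, centrally symmetric and compact in $L_2(0,1)$, with linear span $\Xi$ (so it is the unit ball of a norm that makes $\Xi$ a Banach space); the functions $e_i=\sqrt{P_0}\,i^{-s}\phi_i\in U$, $i\ge1$, form a greedy system of $U$, which means that, with $\Pi_i=\operatorname{span}(e_1,\dots,e_i)$ and $\Pi_0=\{0\}$, the function $e_i$ has the largest $L_2$-distance from $\Pi_{i-1}$ among all elements of $U$; and, with $\tilde S_i$ the difference of $S$ and its orthogonal projection on $\Pi_i$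 (that is, $\tilde S_i=\sum_{j>i}\theta_j\phi_j$): (i) every family $S_\varepsilon\in U$ with $\|S_\varepsilon\|\asymp\varepsilon^{2r}$ as $\varepsilon\to0$ is $\varepsilon^{-2\omega}$-LD consistent; (ii) for every $S\in L_2(0,1)$ with $S\notin\Xi$ there are sequences of natural numbers $i_n\to\infty$, $j_n\to\infty$ and constants $0<c<C$ such that $c\,j_n^{-r}<\|\tilde S_{i_n}\|<C\,j_n^{-r}$ for all $n$, and the sequence of alternatives $\tilde S_{i_n}$, observed at noise level $\varepsilon_n=j_n^{-1/2}$, is $j_n^{\omega}$-LD inconsistent. -/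

import Mathlib

open MeasureTheory ProbabilityTheory Filter Topology Asymptotics

noncomputable section

namespace SignalDetection

/-- The real Hilbert space `L₂(0,1)`. -/
abbrev L2 : Type := Lp ℝ 2 (volume.restrict (Set.Ioo (0 : ℝ) 1))

/-! ### Observations and test statistics

Throughout, the basis `b : HilbertBasis ℕ ℝ L2` is numbered from `0`, so `b j` is `φ_{j+1}`.
The weights `ϰ ε j` are numbered as in the text, from `j = 1`; `ϰ ε 0` is never used. -/

/-- Gaussian white noise `dw` on `(0,1)`: `W f` is the stochastic integral `∫₀¹ f dw`, i.e. `W` is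
the centred Gaussian process indexed by `L₂(0,1)` whose covariance is the inner product. -/
structure IsGaussianWhiteNoise {Ω : Type*} [MeasurableSpace Ω] (μ : Measure Ω)
    (W : L2 → Ω → ℝ) : Prop where
  gaussian : IsGaussianProcess W μ
  mean_zero : ∀ f, ∫ x, W f x ∂μ = 0
  covariance_eq : ∀ f g, cov[W f, W g; μ] = inner ℝ f g

/-- The observation `∫₀¹ f dY_ε`, where `dY_ε = S dt + ε dw`. -/
def observation {Ω : Type*} (W : L2 → Ω → ℝ) (ε : ℝ) (S f : L2) (x : Ω) : ℝ :=
  inner ℝ f S + ε * W f x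

/-- `ρ_ε² = ∑_{j ≥ 1} ϰ²_{εj}`. -/
def rhoSq (ϰ : ℝ → ℕ → ℝ) (ε : ℝ) : ℝ := ∑' j : ℕ, ϰ ε (j + 1) ^ 2

/-- `A_ε = ε⁻⁴ ∑_{j ≥ 1} ϰ⁴_{εj}`. -/
def bigA (ϰ : ℝ → ℕ → ℝ) (ε : ℝ) : ℝ := (ε ^ 4)⁻¹ * ∑' j : ℕ, ϰ ε (j + 1) ^ 4

/-- `k_ε = sup {k : ∑_{1 ≤ j < k} ϰ²_{εj} ≤ ρ_ε² / 2}`. -/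
def kEps (ϰ : ℝ → ℕ → ℝ) (ε : ℝ) : ℕ :=
  sSup {k : ℕ | ∑ j ∈ Finset.Ico 1 k, ϰ ε j ^ 2 ≤ rhoSq ϰ ε / 2}

/-- `ϰ_ε² = ϰ²_{ε, k_ε}`. -/
def kappaSq (ϰ : ℝ → ℕ → ℝ) (ε : ℝ) : ℝ := ϰ ε (kEps ϰ ε) ^ 2

/-- Conditions A1–A4 on the weights `ϰ²_{εj}`, together with the convergence of the series
`ρ_ε² = ∑ ϰ²_{εj}`, without which the test statistic is not defined. -/
structure WeightConditions (ϰ : ℝ → ℕ → ℝ) : Prop where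
  summable : ∀ ε > 0, Summable fun j : ℕ => ϰ ε (j + 1) ^ 2
  A1 : ∀ ε > 0, ∀ j ≥ 1, ϰ ε (j + 1) ^ 2 ≤ ϰ ε j ^ 2
  A2 : ∃ C₁ > 0, ∃ C₂ > 0, ∀ ε > 0, C₁ < bigA ϰ ε ∧ bigA ϰ ε < C₂
  A3 : ∃ C₁ > 0, ∃ lam > (1 : ℝ), ∀ δ > (0 : ℝ), ∀ ε > 0,
    ϰ ε ⌊(1 + δ) * (kEps ϰ ε : ℝ)⌋₊ ^ 2 < C₁ * (1 + δ) ^ (-lam) * kappaSq ϰ ε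
  A4_first : (fun ε => ϰ ε 1 ^ 2) =Θ[𝓝[>] 0] kappaSq ϰ
  A4 : ∀ c > (1 : ℝ), ∃ C > 0, ∀ ε > 0,
    C * kappaSq ϰ ε ≤ ϰ ε ⌊c * (kEps ϰ ε : ℝ)⌋₊ ^ 2

section Tests

variable {Ω : Type*} [MeasurableSpace Ω]

/-- The Neyman type statistic `T_ε(Y_ε) = ε⁻² ∑_j ϰ²_{εj} y²_{εj} - ρ_ε²`, `y_{εj} = ∫ φ_j dY_ε`,
when the signal is `S`. -/
def neymanStat (W : L2 → Ω → ℝ) (b : HilbertBasis ℕ ℝ L2) (ϰ : ℝ → ℕ → ℝ)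
    (ε : ℝ) (S : L2) (x : Ω) : ℝ :=
  (ε ^ 2)⁻¹ * ∑' j : ℕ, ϰ ε (j + 1) ^ 2 * observation W ε S (b j) x ^ 2 - rhoSq ϰ ε

/-- The type I error probability of the test `1{A_ε^{-1/2} T_ε > t}`. -/
def typeIError (μ : Measure Ω) (W : L2 → Ω → ℝ) (b : HilbertBasis ℕ ℝ L2) (ϰ : ℝ → ℕ → ℝ)
    (ε t : ℝ) : ENNReal :=
  μ {x | (√(bigA ϰ ε))⁻¹ * neymanStat W b ϰ ε 0 x > t}

/-- The type II error probability, at the alternative `S`, of the test `1{A_ε^{-1/2} T_ε > t}`. -/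
def typeIIError (μ : Measure Ω) (W : L2 → Ω → ℝ) (b : HilbertBasis ℕ ℝ L2) (ϰ : ℝ → ℕ → ℝ)
    (ε t : ℝ) (S : L2) : ENNReal :=
  μ {x | ¬ (√(bigA ϰ ε))⁻¹ * neymanStat W b ϰ ε S x > t}

/-- LD consistency with rate `R` of the alternatives `S i`, observed at noise level `ε i`, along
the filter `l`: for all critical values `t i` such that `R⁻² log α → 0`, one has
`|log β| = Ω(R²)`. Logarithms take values in `[-∞, ∞]`, so `|log 0| = ∞`. The index `i` is the noise
level itself for families `(S_ε)`, `ε → 0`, and `n → ∞` for sequences. -/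
def IsLDConsistent (μ : Measure Ω) (W : L2 → Ω → ℝ) (b : HilbertBasis ℕ ℝ L2) (ϰ : ℝ → ℕ → ℝ)
    {ι : Type*} (l : Filter ι) (ε : ι → ℝ) (S : ι → L2) (R : ι → ℝ) : Prop :=
  ∀ t : ι → ℝ,
    Tendsto (fun i => (((R i ^ 2)⁻¹ : ℝ) : EReal) * ENNReal.log (typeIError μ W b ϰ (ε i) (t i)))
      l (𝓝 0) →
    ∃ C > (0 : ℝ), ∀ᶠ i in l, ENNReal.ofReal (R i ^ 2) ≤
      ENNReal.ofReal C * (ENNReal.log (typeIIError μ W b ϰ (ε i) (t i) (S i))).abs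

end Tests

/-! ### Besov type balls -/

/-- The ball `B̄^s_{2∞}(P₀)`: `sup_{λ>0} λ^{2s} ∑_{j>λ} θ_j² ≤ P₀` for the Fourier coefficients
`θ_j` of `S` in the basis. -/
def besovBall (b : HilbertBasis ℕ ℝ L2) (s P₀ : ℝ) : Set L2 :=
  {S | ∀ lam > (0 : ℝ), lam ^ (2 * s) *
    ∑' j : ℕ, (if lam < (j : ℝ) + 1 then (inner ℝ (b j) S : ℝ) ^ 2 else 0) ≤ P₀}

/-- The space `B̄^s_{2∞}`: the supremum over `λ` is finite. -/
def besovSpace (b : HilbertBasis ℕ ℝ L2) (s : ℝ) : Set L2 :=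
  {S | ∃ P : ℝ, S ∈ besovBall b s P}

/-! ### Maxisets -/

/-- The subspace `Π_i` spanned by the first `i` functions of the sequence `e`. -/
def greedySpan (e : ℕ → L2) (i : ℕ) : Submodule ℝ L2 :=
  Submodule.span ℝ (Set.range fun k : Fin i => e k)

instance (e : ℕ → L2) (i : ℕ) : FiniteDimensional ℝ (greedySpan e i) :=
  FiniteDimensional.span_of_finite ℝ (Set.finite_range _)

/-- `e` is a system of functions of `U` chosen inductively: `e i` (the `(i+1)`-st function) has the
largest distance from `Π_i` among the elements of `U`. For `i = 0` this is the largest norm. -/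
def IsGreedySystem (U : Set L2) (e : ℕ → L2) : Prop :=
  ∀ i, e i ∈ U ∧ ∀ S ∈ U,
    Metric.infDist S (greedySpan e i : Set L2) ≤ Metric.infDist (e i) (greedySpan e i : Set L2)

/-- The residual `S̃_i = S - S_{Π_i}`. -/
def greedyResidual (e : ℕ → L2) (S : L2) (i : ℕ) : L2 :=
  S - (greedySpan e i).starProjection S

/-- `U` is a maxiset and `Ξ` is a maxispace for the statistics `T_ε`, with the functions `e` chosen
in the inductive construction of the subspaces `Π_i`. The first four fields say that `U` is the
unit ball of a Banach space with underlying set `Ξ`, compact in `L₂(0,1)` (the gauge of a compact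
convex symmetric set is a complete norm on its span, and the set is its closed unit ball). -/
structure IsMaxiset {Ω : Type*} [MeasurableSpace Ω] (μ : Measure Ω) (W : L2 → Ω → ℝ)
    (b : HilbertBasis ℕ ℝ L2) (ϰ : ℝ → ℕ → ℝ) (r ω : ℝ) (U Ξ : Set L2) (e : ℕ → L2) : Prop where
  convex : Convex ℝ U
  symmetric : ∀ S ∈ U, -S ∈ U
  compact : IsCompact U
  span_eq : (Submodule.span ℝ U : Set L2) = Ξ
  greedy : IsGreedySystem U e
  /-- Property i. -/
  consistent : ∀ S : ℝ → L2, (∀ᶠ ε in 𝓝[>] 0, S ε ∈ U) →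
    (fun ε => ‖S ε‖) =Θ[𝓝[>] 0] (fun ε : ℝ => ε ^ (2 * r)) →
    IsLDConsistent μ W b ϰ (𝓝[>] 0) (fun ε : ℝ => ε) S (fun ε : ℝ => ε ^ (-(2 * ω)))
  /-- Property ii. -/
  inconsistent : ∀ S : L2, S ∉ Ξ → ∃ i j : ℕ → ℕ,
    Tendsto i atTop atTop ∧ Tendsto j atTop atTop ∧
    (∃ c > 0, ∃ C > 0, ∀ n, c * (j n : ℝ) ^ (-r) < ‖greedyResidual e S (i n)‖ ∧
      ‖greedyResidual e S (i n)‖ < C * (j n : ℝ) ^ (-r)) ∧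
    ¬ IsLDConsistent μ W b ϰ atTop (fun n => (j n : ℝ) ^ (-(1 / 2 : ℝ)))
      (fun n => greedyResidual e S (i n)) (fun n => (j n : ℝ) ^ ω)

end SignalDetection

end

/-! Write a_j for the weights, σ² = ∑ a_j², ξ_j = W(φ_j) and h_j = θ_j/ε. The ξ_j are independent
standard normal, the statistic is ∑ a_j((ξ_j + h_j)² - 1), and the test compares it with τσ, where τ
= t/ε². Its mean is the drift D = ∑ a_j h_j². As long as the deviations y in play satisfy y·a_1 ≲ σ,
the statistic has Gaussian-type tails exp(-const·y²) at distance yσ from its mean. Hence consistency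
at rate R amounts to D ≳ Rσ. If D ≥ cRσ, a critical value with log α = o(R²) must satisfy τ ≤ cR/4,
and then β ≤ exp(-const·R²) (`isLDConsistent_of_le_drift`). If D = o(Rσ), the choice τ = 2D/σ + 5 =
o(R) keeps log α = o(R²), by a second-moment lower bound on the tail (`le_measure_tsum_sq_gt`),
while β ≥ 1/2 (`not_isLDConsistent_of_drift`). Put q = 2 - 4r - 2ω, so that k_ε ≍ ε^(-2q), k_ε^(-s)
≍ ε^(2r), and ϰ_ε² ≍ ε^q σ because σ ≍ √k_ε ϰ_ε². With R = ε^(-2ω), a signal of squared norm ε^(4r)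
carried by the first O(k_ε) coordinates has drift of order ϰ_ε² ε^(4r-2) ≍ Rσ. A signal of the ball
has tail at most √P₀(a k_ε)^(-s) beyond a·k_ε, negligible against ε^(2r) for a large, so a fixed
share of its energy is seen. If S lies outside the space, i^s‖S̃_i‖ is unbounded; matching ε to
‖S̃_i‖ ≍ ε^(2r) then forces i/k_ε → ∞, where A3 makes the weights, and so the drift, negligible. -/

noncomputable section

namespace SignalDetection

/-! ### Laplace transforms of weighted sums of noncentral χ² variables. -/

section QuadraticForms

/-- The moment generating function of a noncentral `χ²` variable with one degree of freedom. -/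
theorem lintegral_exp_mul_sq_gaussianReal {c : ℝ} (hc : c < 1 / 2) (h : ℝ) :
    ∫⁻ x, ENNReal.ofReal (Real.exp (c * (x + h) ^ 2)) ∂(gaussianReal 0 1) =
      ENNReal.ofReal ((√(1 - 2 * c))⁻¹ * Real.exp (c / (1 - 2 * c) * h ^ 2)) := by
  have hd : 0 < 1 - 2 * c := by linarith
  obtain ⟨v, hvc⟩ : ∃ v : NNReal, (v : ℝ) = (1 - 2 * c)⁻¹ := ⟨⟨_, by positivity⟩, rfl⟩
  have hv0 : v ≠ 0 := by
    rw [← NNReal.coe_ne_zero, hvc]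
    exact (inv_pos.2 hd).ne'
  rw [gaussianReal_of_var_ne_zero _ one_ne_zero,
    lintegral_withDensity_eq_lintegral_mul _ (measurable_gaussianPDF 0 1) (by fun_prop)]
  -- Completing the square: the tilted density is a constant times the Gaussian density with mean
  -- 2ch/(1-2c) and variance 1/(1-2c).
  have key : ∀ x : ℝ, (gaussianPDF 0 1 * fun x => ENNReal.ofReal (Real.exp (c * (x + h) ^ 2))) x =
      ENNReal.ofReal ((√(1 - 2 * c))⁻¹ * Real.exp (c / (1 - 2 * c) * h ^ 2)) *
        gaussianPDF (2 * c * h / (1 - 2 * c)) v x := by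
    intro x
    simp only [Pi.mul_apply, gaussianPDF]
    rw [← ENNReal.ofReal_mul (gaussianPDFReal_nonneg _ _ _), ← ENNReal.ofReal_mul (by positivity)]
    congr 1
    simp only [gaussianPDFReal, hvc, NNReal.coe_one]
    rw [Real.sqrt_mul' _ (by positivity : (0 : ℝ) ≤ (1 - 2 * c)⁻¹), Real.sqrt_inv]
    have hs : √(1 - 2 * c) ≠ 0 := (Real.sqrt_pos.2 hd).ne'
    have e1 : ∀ A B C D E : ℝ, A + B = C + D → E * Real.exp A * Real.exp B =
        E * (Real.exp C * Real.exp D) := by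
      intro A B C D E hh
      rw [mul_assoc, ← Real.exp_add, ← Real.exp_add, hh]
    rw [e1 _ _ (c / (1 - 2 * c) * h ^ 2)
      (-(x - 2 * c * h / (1 - 2 * c)) ^ 2 / (2 * (1 - 2 * c)⁻¹)) _ ?_]
    · field_simp
    · field_simp
      ring
  rw [lintegral_congr key, lintegral_const_mul _ (measurable_gaussianPDF _ _),
    lintegral_gaussianPDF_eq_one _ hv0, mul_one]

/-- Follows from log x ≥ 1 - 1/x. There is no lower bound on `c`, since lower tails use negative
exponents. -/
theorem inv_sqrt_one_sub_le_exp {c : ℝ} (hc : c ≤ 1 / 4) :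
    (√(1 - 2 * c))⁻¹ ≤ Real.exp (c + 4 * c ^ 2) := by
  have hd : 0 < 1 - 2 * c := by linarith
  have h1 := Real.one_sub_inv_le_log_of_pos hd
  have h2 : -(2 * c) - 8 * c ^ 2 ≤ 1 - (1 - 2 * c)⁻¹ := by
    have : 1 - (1 - 2 * c)⁻¹ - (-(2 * c) - 8 * c ^ 2) = 4 * c ^ 2 * (1 - 4 * c) / (1 - 2 * c) := by
      field_simp
      ring
    have h3 : 0 ≤ 4 * c ^ 2 * (1 - 4 * c) / (1 - 2 * c) :=
      div_nonneg (mul_nonneg (by positivity) (by linarith)) hd.le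
    linarith
  rw [inv_le_comm₀ (Real.sqrt_pos.2 hd) (Real.exp_pos _), ← Real.exp_neg]
  apply Real.le_sqrt_of_sq_le
  rw [← Real.exp_nat_mul, ← Real.le_log_iff_exp_le hd]
  push_cast
  linarith

/-- Keep the first two terms, all being nonnegative, of the series of -log(1 - 2c). -/
theorem exp_le_inv_sqrt_one_sub {c : ℝ} (h0 : 0 ≤ c) (hc : c < 1 / 2) :
    Real.exp (c + c ^ 2) ≤ (√(1 - 2 * c))⁻¹ := by
  have hd : 0 < 1 - 2 * c := by linarith
  have hs := Real.hasSum_pow_div_log_of_abs_lt_one (x := 2 * c)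
    (by rw [abs_of_nonneg (by linarith)]; linarith)
  have h1 := sum_le_hasSum (Finset.range 2) (fun n _ => by positivity) hs
  simp only [Finset.sum_range_succ, Finset.sum_range_zero] at h1
  norm_num at h1
  rw [le_inv_comm₀ (Real.exp_pos _) (Real.sqrt_pos.2 hd), ← Real.exp_neg]
  rw [Real.sqrt_le_left (Real.exp_pos _).le, ← Real.exp_nat_mul, ← Real.log_le_iff_le_exp hd]
  push_cast
  nlinarith

variable {Ω : Type*} [MeasurableSpace Ω] {μ : Measure Ω} {ξ : ℕ → Ω → ℝ}

theorem lintegral_exp_sum_sq (hind : iIndepFun ξ μ) (hlaw : ∀ j, HasLaw (ξ j) (gaussianReal 0 1) μ)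
    (h c : ℕ → ℝ) (hc : ∀ j, c j < 1 / 2) (N : ℕ) :
    ∫⁻ x, ENNReal.ofReal (Real.exp (∑ j ∈ Finset.range N, c j * (ξ j x + h j) ^ 2)) ∂μ =
      ENNReal.ofReal (∏ j ∈ Finset.range N,
        ((√(1 - 2 * c j))⁻¹ * Real.exp (c j / (1 - 2 * c j) * h j ^ 2))) := by
  have hm := fun j => (hlaw j).aemeasurable
  set η : ℕ → Ω → ℝ := fun j => (hm j).mk (ξ j) with hη
  have hηξ : ∀ j, ξ j =ᵐ[μ] η j := fun j => (hm j).ae_eq_mk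
  have hηind : iIndepFun η μ := hind.congr hηξ
  have hηm : ∀ j, Measurable (η j) := fun j => (hm j).measurable_mk
  have hηlaw : ∀ j, HasLaw (η j) (gaussianReal 0 1) μ := fun j => (hlaw j).congr (hηξ j).symm
  have hF : ∀ j, Measurable fun y : ℝ => ENNReal.ofReal (Real.exp (c j * (y + h j) ^ 2)) :=
    fun j => by fun_prop
  have hall : ∀ᵐ x ∂μ, ∀ j, ξ j x = η j x := ae_all_iff.2 hηξ
  calc _ = ∫⁻ x, ∏ j ∈ Finset.range N,
        ENNReal.ofReal (Real.exp (c j * (η j x + h j) ^ 2)) ∂μ := by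
        apply lintegral_congr_ae
        filter_upwards [hall] with x hx
        rw [← ENNReal.ofReal_prod_of_nonneg fun _ _ => (Real.exp_pos _).le, ← Real.exp_sum]
        simp only [hx]
    _ = ∏ j ∈ Finset.range N, ∫⁻ x, ENNReal.ofReal (Real.exp (c j * (η j x + h j) ^ 2)) ∂μ :=
        lintegral_prod_eq_prod_lintegral_of_indepFun (Finset.range N)
          (fun j x => ENNReal.ofReal (Real.exp (c j * (η j x + h j) ^ 2)))
          (hηind.comp _ hF) (fun j => (hF j).comp (hηm j))
    _ = _ := by
        rw [ENNReal.ofReal_prod_of_nonneg fun _ _ => by positivity]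
        refine Finset.prod_congr rfl fun j _ => ?_
        rw [(hηlaw j).lintegral_comp (f := fun y => ENNReal.ofReal (Real.exp (c j * (y + h j) ^ 2)))
          (hF j).aemeasurable, lintegral_exp_mul_sq_gaussianReal (hc j)]

/-- The sum ∑ a_j ξ_j² has finite expectation ∑ a_j, and (ξ + h)² ≤ 2ξ² + 2h². Without summability
`tsum` would take its default value 0. -/
theorem ae_summable_mul_sq (hlaw : ∀ j, HasLaw (ξ j) (gaussianReal 0 1) μ) {a h : ℕ → ℝ}
    (ha0 : ∀ j, 0 ≤ a j) (ha : Summable a) (hah : Summable fun j => a j * h j ^ 2) :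
    ∀ᵐ x ∂μ, Summable fun j => a j * (ξ j x + h j) ^ 2 := by
  have hsq : ∀ j, ∫⁻ x, ENNReal.ofReal (ξ j x ^ 2) ∂μ = 1 := by
    intro j
    rw [(hlaw j).lintegral_comp (f := fun y => ENNReal.ofReal (y ^ 2)) (by fun_prop)]
    have hv := variance_id_gaussianReal (μ := 0) (v := 1)
    have hi : Integrable (fun y : ℝ => y ^ 2) (gaussianReal 0 1) :=
      (memLp_id_gaussianReal (μ := 0) (v := 1) 2).integrable_sq
    rw [← ofReal_integral_eq_lintegral_ofReal hi (ae_of_all _ fun _ => sq_nonneg _)]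
    rw [variance_of_integral_eq_zero (by fun_prop) (by simp)] at hv
    simp only [id] at hv
    rw [hv]
    simp
  have hfin : ∫⁻ x, ∑' j, ENNReal.ofReal (a j * ξ j x ^ 2) ∂μ ≠ ⊤ := by
    rw [lintegral_tsum fun j =>
      ((hlaw j).aemeasurable.pow_const 2).const_mul (a j) |>.ennreal_ofReal]
    have : ∀ j, ∫⁻ x, ENNReal.ofReal (a j * ξ j x ^ 2) ∂μ = ENNReal.ofReal (a j) := by
      intro j
      simp_rw [ENNReal.ofReal_mul (ha0 j)]
      rw [lintegral_const_mul' _ _ ENNReal.ofReal_ne_top, hsq, mul_one]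
    simp_rw [this]
    exact ha.tsum_ofReal_ne_top
  have hmeas : AEMeasurable (fun x => ∑' j, ENNReal.ofReal (a j * ξ j x ^ 2)) μ :=
    AEMeasurable.tsum fun j =>
      ((hlaw j).aemeasurable.pow_const 2).const_mul (a j) |>.ennreal_ofReal
  filter_upwards [ae_lt_top' hmeas hfin] with x hx
  have h1 : Summable fun j => a j * ξ j x ^ 2 := by
    have := ENNReal.summable_toReal hx.ne
    refine this.congr fun j => ?_
    rw [ENNReal.toReal_ofReal (mul_nonneg (ha0 j) (sq_nonneg _))]
  refine Summable.of_nonneg_of_le (fun j => mul_nonneg (ha0 j) (sq_nonneg _)) (fun j => ?_)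
    ((h1.mul_left 2).add (hah.mul_left 2))
  nlinarith [mul_nonneg (ha0 j) (sq_nonneg (ξ j x - h j))]

theorem aemeasurable_tsum_mul_sq (hlaw : ∀ j, HasLaw (ξ j) (gaussianReal 0 1) μ) (a h : ℕ → ℝ) :
    AEMeasurable (fun x => ∑' j, a j * (ξ j x + h j) ^ 2) μ :=
  AEMeasurable.tsum fun j => (((hlaw j).aemeasurable.add_const _).pow_const 2).const_mul _

/-- Upper bound for the Laplace transform of `∑ a_j (ξ_j + h_j)²`. -/
theorem lintegral_exp_tsum_sq_le (hind : iIndepFun ξ μ)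
    (hlaw : ∀ j, HasLaw (ξ j) (gaussianReal 0 1) μ) {a h : ℕ → ℝ}
    (ha0 : ∀ j, 0 ≤ a j) (ha : Summable a) (ha2 : Summable fun j => a j ^ 2)
    (hah : Summable fun j => a j * h j ^ 2) {u w : ℝ} (hu : ∀ j, u * a j ≤ 1 / 4)
    (hw : ∀ j, u * a j / (1 - 2 * (u * a j)) ≤ w * a j) :
    ∫⁻ x, ENNReal.ofReal (Real.exp (u * ∑' j, a j * (ξ j x + h j) ^ 2)) ∂μ ≤
      ENNReal.ofReal (Real.exp (u * ∑' j, a j + 4 * u ^ 2 * ∑' j, a j ^ 2 +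
        w * ∑' j, a j * h j ^ 2)) := by
  have hN : ∀ N : ℕ,
      ∫⁻ x, ENNReal.ofReal (Real.exp (u * ∑ j ∈ Finset.range N, a j * (ξ j x + h j) ^ 2)) ∂μ ≤
      ENNReal.ofReal (Real.exp (u * ∑ j ∈ Finset.range N, a j +
        4 * u ^ 2 * ∑ j ∈ Finset.range N, a j ^ 2 +
        w * ∑ j ∈ Finset.range N, a j * h j ^ 2)) := by
    intro N
    have := lintegral_exp_sum_sq hind hlaw h (fun j => u * a j)
      (fun j => by linarith [hu j]) N
    simp only [mul_assoc u, ← Finset.mul_sum] at this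
    rw [this]
    apply ENNReal.ofReal_le_ofReal
    simp only [Finset.mul_sum, ← Finset.sum_add_distrib, Real.exp_sum]
    refine Finset.prod_le_prod (fun _ _ => by positivity) fun j _ => ?_
    rw [Real.exp_add]
    refine mul_le_mul ?_ (Real.exp_le_exp.2 ?_) (Real.exp_pos _).le (Real.exp_pos _).le
    · refine (inv_sqrt_one_sub_le_exp (hu j)).trans_eq ?_
      congr 1
      ring
    · rw [← mul_assoc w]
      exact mul_le_mul_of_nonneg_right (hw j) (sq_nonneg _)
  have hlim : Tendsto (fun N : ℕ => ENNReal.ofReal (Real.exp (u * ∑ j ∈ Finset.range N, a j +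
        4 * u ^ 2 * ∑ j ∈ Finset.range N, a j ^ 2 +
        w * ∑ j ∈ Finset.range N, a j * h j ^ 2))) atTop (𝓝 (ENNReal.ofReal (Real.exp
          (u * ∑' j, a j + 4 * u ^ 2 * ∑' j, a j ^ 2 + w * ∑' j, a j * h j ^ 2)))) := by
    refine ENNReal.tendsto_ofReal ((Real.continuous_exp.tendsto _).comp ?_)
    exact ((ha.hasSum.tendsto_sum_nat.const_mul u).add
      (ha2.hasSum.tendsto_sum_nat.const_mul _)).add (hah.hasSum.tendsto_sum_nat.const_mul w)
  -- Fatou's lemma carries the bound from partial sums to the limit and works for either sign of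
  -- `u`.
  have hF : ∀ᵐ x ∂μ, ENNReal.ofReal (Real.exp (u * ∑' j, a j * (ξ j x + h j) ^ 2)) ≤
      liminf (fun N : ℕ => ENNReal.ofReal
        (Real.exp (u * ∑ j ∈ Finset.range N, a j * (ξ j x + h j) ^ 2))) atTop := by
    filter_upwards [ae_summable_mul_sq hlaw ha0 ha hah] with x hx
    exact (Tendsto.liminf_eq (ENNReal.tendsto_ofReal ((Real.continuous_exp.tendsto _).comp
      (hx.hasSum.tendsto_sum_nat.const_mul u)))).ge
  calc _ ≤ _ := lintegral_mono_ae hF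
    _ ≤ _ := lintegral_liminf_le' fun N => by
        have : AEMeasurable (fun x => ∑ j ∈ Finset.range N, a j * (ξ j x + h j) ^ 2) μ :=
          Finset.aemeasurable_fun_sum _ fun j _ =>
            (((hlaw j).aemeasurable.add_const _).pow_const 2).const_mul _
        exact (Real.measurable_exp.comp_aemeasurable (this.const_mul u)).ennreal_ofReal
    _ ≤ _ := liminf_le_liminf (Eventually.of_forall hN)
    _ = _ := hlim.liminf_eq

/-- Lower bound for the Laplace transform of `∑ a_j ξ_j²`. -/
theorem le_lintegral_exp_tsum_sq (hind : iIndepFun ξ μ)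
    (hlaw : ∀ j, HasLaw (ξ j) (gaussianReal 0 1) μ) {a : ℕ → ℝ}
    (ha0 : ∀ j, 0 ≤ a j) (ha : Summable a) (ha2 : Summable fun j => a j ^ 2)
    {u : ℝ} (hu0 : 0 ≤ u) (hu : ∀ j, u * a j ≤ 1 / 4) :
    ENNReal.ofReal (Real.exp (u * ∑' j, a j + u ^ 2 * ∑' j, a j ^ 2)) ≤
      ∫⁻ x, ENNReal.ofReal (Real.exp (u * ∑' j, a j * ξ j x ^ 2)) ∂μ := by
  have hlim : Tendsto (fun N : ℕ => ENNReal.ofReal (Real.exp (u * ∑ j ∈ Finset.range N, a j +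
        u ^ 2 * ∑ j ∈ Finset.range N, a j ^ 2))) atTop (𝓝 (ENNReal.ofReal (Real.exp
          (u * ∑' j, a j + u ^ 2 * ∑' j, a j ^ 2)))) := by
    refine ENNReal.tendsto_ofReal ((Real.continuous_exp.tendsto _).comp ?_)
    exact (ha.hasSum.tendsto_sum_nat.const_mul u).add (ha2.hasSum.tendsto_sum_nat.const_mul _)
  refine le_of_tendsto' hlim fun N => ?_
  have := lintegral_exp_sum_sq hind hlaw (fun _ => 0) (fun j => u * a j)
      (fun j => by linarith [hu j]) N
  simp only [mul_assoc u, ← Finset.mul_sum, add_zero] at this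
  calc _ ≤ _ := ?_
    _ = _ := this.symm
    _ ≤ _ := ?_
  · apply ENNReal.ofReal_le_ofReal
    simp only [Finset.mul_sum, ← Finset.sum_add_distrib, Real.exp_sum]
    refine Finset.prod_le_prod (fun _ _ => by positivity) fun j _ => ?_
    have := exp_le_inv_sqrt_one_sub (mul_nonneg hu0 (ha0 j)) (by linarith [hu j])
    simpa [mul_pow] using this
  · have hs := ae_summable_mul_sq (h := fun _ => 0) hlaw ha0 ha (by simp)
    refine lintegral_mono_ae ?_
    filter_upwards [hs] with x hx
    simp only [add_zero] at hx
    refine ENNReal.ofReal_le_ofReal (Real.exp_le_exp.2 (mul_le_mul_of_nonneg_left ?_ hu0))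
    exact hx.sum_le_tsum _ fun j _ => mul_nonneg (ha0 j) (sq_nonneg _)

end QuadraticForms

/-! ### Upper and lower tail bounds for the quadratic forms. -/

section Tails

variable {Ω : Type*} [MeasurableSpace Ω] {μ : Measure Ω} {ξ : ℕ → Ω → ℝ}

theorem measure_le_ofReal_exp_sub {s : Set Ω} {f : Ω → ℝ} {A B : ℝ} (hf : AEMeasurable f μ)
    (hs : ∀ x ∈ s, B ≤ f x)
    (hA : ∫⁻ x, ENNReal.ofReal (Real.exp (f x)) ∂μ ≤ ENNReal.ofReal (Real.exp A)) :
    μ s ≤ ENNReal.ofReal (Real.exp (A - B)) := by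
  have hm : AEMeasurable (fun x => ENNReal.ofReal (Real.exp (f x))) μ :=
    (Real.measurable_exp.comp_aemeasurable hf).ennreal_ofReal
  have h0 : ENNReal.ofReal (Real.exp B) ≠ 0 := by
    simpa using Real.exp_pos B
  have h1 := mul_meas_ge_le_lintegral₀ hm (ENNReal.ofReal (Real.exp B))
  have h2 : μ s ≤ μ {x | ENNReal.ofReal (Real.exp B) ≤ ENNReal.ofReal (Real.exp (f x))} :=
    measure_mono fun x hx => ENNReal.ofReal_le_ofReal (Real.exp_le_exp.2 (hs x hx))
  rw [Real.exp_sub, ENNReal.ofReal_div_of_pos (Real.exp_pos B)]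
  rw [ENNReal.le_div_iff_mul_le (Or.inl h0) (Or.inl ENNReal.ofReal_ne_top), mul_comm]
  exact (mul_le_mul_right h2 _).trans (h1.trans hA)

theorem measure_tsum_sq_gt_le (hind : iIndepFun ξ μ)
    (hlaw : ∀ j, HasLaw (ξ j) (gaussianReal 0 1) μ) {a h : ℕ → ℝ}
    (ha0 : ∀ j, 0 ≤ a j) (ha : Summable a) (ha2 : Summable fun j => a j ^ 2)
    (hah : Summable fun j => a j * h j ^ 2) {u : ℝ} (hu0 : 0 ≤ u) (hu : ∀ j, u * a j ≤ 1 / 4)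
    (y : ℝ) :
    μ {x | y < ∑' j, a j * (ξ j x + h j) ^ 2 - ∑' j, a j} ≤
      ENNReal.ofReal (Real.exp
        (4 * u ^ 2 * ∑' j, a j ^ 2 + 2 * u * ∑' j, a j * h j ^ 2 - u * y)) := by
  -- For 0 ≤ c ≤ 1/4, c/(1-2c) ≤ 2c.
  have hL := lintegral_exp_tsum_sq_le hind hlaw ha0 ha ha2 hah (w := 2 * u) hu fun j => by
    have h1 := mul_nonneg hu0 (ha0 j)
    rw [div_le_iff₀ (by linarith [hu j])]
    nlinarith [hu j]
  have := measure_le_ofReal_exp_sub (s := {x | y < ∑' j, a j * (ξ j x + h j) ^ 2 - ∑' j, a j})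
    (B := u * (y + ∑' j, a j)) ((aemeasurable_tsum_mul_sq hlaw a h).const_mul u)
    (fun x hx => mul_le_mul_of_nonneg_left
      (by simp only [Set.mem_ofPred_eq] at hx; linarith) hu0) hL
  refine this.trans_eq ?_
  congr 2
  ring

theorem measure_tsum_sq_le_le (hind : iIndepFun ξ μ)
    (hlaw : ∀ j, HasLaw (ξ j) (gaussianReal 0 1) μ) {a h : ℕ → ℝ}
    (ha0 : ∀ j, 0 ≤ a j) (ha : Summable a) (ha2 : Summable fun j => a j ^ 2)
    (hah : Summable fun j => a j * h j ^ 2) {u : ℝ} (hu0 : 0 ≤ u) (hu : ∀ j, u * a j ≤ 1 / 4)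
    (y : ℝ) :
    μ {x | ∑' j, a j * (ξ j x + h j) ^ 2 - ∑' j, a j ≤ y} ≤
      ENNReal.ofReal (Real.exp
        (4 * u ^ 2 * ∑' j, a j ^ 2 - u / 2 * ∑' j, a j * h j ^ 2 + u * y)) := by
  -- For 0 ≤ c ≤ 1/4, c/(1+2c) ≥ c/2: the lower tail keeps at least half of the drift.
  have hL := lintegral_exp_tsum_sq_le hind hlaw ha0 ha ha2 hah (u := -u) (w := -(u / 2))
    (fun j => by linarith [mul_nonneg hu0 (ha0 j)]) fun j => by
      have h1 := mul_nonneg hu0 (ha0 j)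
      rw [div_le_iff₀ (by linarith [hu j])]
      nlinarith [hu j]
  have := measure_le_ofReal_exp_sub (s := {x | ∑' j, a j * (ξ j x + h j) ^ 2 - ∑' j, a j ≤ y})
    (B := -u * (y + ∑' j, a j)) ((aemeasurable_tsum_mul_sq hlaw a h).const_mul (-u))
    (fun x hx => mul_le_mul_of_nonpos_left
      (by simp only [Set.mem_ofPred_eq] at hx; linarith) (by linarith)) hL
  refine this.trans_eq ?_
  congr 2
  ring

/-- Moderate deviation lower bound for a weighted sum of centred `χ²` variables. -/
theorem le_measure_tsum_sq_gt (hind : iIndepFun ξ μ)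
    (hlaw : ∀ j, HasLaw (ξ j) (gaussianReal 0 1) μ) {a : ℕ → ℝ}
    (ha0 : ∀ j, 0 ≤ a j) (ha : Summable a) (ha2 : Summable fun j => a j ^ 2)
    {σ t : ℝ} (hσ : 0 < σ) (hV : ∑' j, a j ^ 2 = σ ^ 2) (ht : 1 ≤ t)
    (hu : ∀ j, 16 * t * a j ≤ σ) :
    ENNReal.ofReal (Real.exp (-(56 * t ^ 2)) / 4) ≤
      μ {x | t * σ < ∑' j, a j * ξ j x ^ 2 - ∑' j, a j} := by
  have : IsProbabilityMeasure μ := hind.isProbabilityMeasure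
  set E := {x | t * σ < ∑' j, a j * ξ j x ^ 2 - ∑' j, a j} with hE
  set ρ := ∑' j, a j
  set Q : Ω → ℝ := fun x => ∑' j, a j * ξ j x ^ 2 with hQ
  -- With this tilt, E exp(uQ) is at least `m` = exp(uρ + 4t²), whereas outside `E` the integrand is
  -- at most exp(uρ + 2t²) ≤ m/2. So `E` must carry mass; the moment at 2u, bounded by `B`,
  -- quantifies this.
  set u := 2 * t / σ with hudef
  have ht0 : 0 < t := by linarith
  have hu0 : 0 < u := by positivity
  have huσ : u * σ = 2 * t := by rw [hudef]; field_simp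
  have hua : ∀ j, 2 * u * a j ≤ 1 / 4 := by
    intro j
    rw [hudef, show 2 * (2 * t / σ) * a j = (4 * t * a j) / σ by ring, div_le_iff₀ hσ]
    linarith [hu j]
  have hz : Summable fun j => a j * (0 : ℝ) ^ 2 := by simp
  have hQm : AEMeasurable Q μ := by
    simpa using aemeasurable_tsum_mul_sq hlaw a (fun _ => 0)
  have hlow := le_lintegral_exp_tsum_sq hind hlaw ha0 ha ha2 hu0.le
    (fun j => by nlinarith [hua j, mul_nonneg hu0.le (ha0 j)])
  have hup := lintegral_exp_tsum_sq_le (h := fun _ => 0) hind hlaw ha0 ha ha2 hz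
    (u := 2 * u) (w := 4 * u) hua fun j => by
      have h1 := mul_nonneg hu0.le (ha0 j)
      rw [div_le_iff₀ (by linarith [hua j])]
      nlinarith [hua j]
  simp only [add_zero, ne_eq, OfNat.ofNat_ne_zero, not_false_eq_true, zero_pow, mul_zero,
    tsum_zero] at hup
  rw [hV] at hlow hup
  have e1 : u * ρ + u ^ 2 * σ ^ 2 = u * ρ + 4 * t ^ 2 := by
    rw [← mul_pow, huσ]; ring
  have e2 : 2 * u * ρ + 4 * (2 * u) ^ 2 * σ ^ 2 = 2 * (u * ρ) + 64 * t ^ 2 := by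
    rw [mul_assoc 4, ← mul_pow, mul_assoc 2 u σ, huσ]; ring
  rw [e1] at hlow
  rw [e2] at hup
  set m := Real.exp (u * ρ + 4 * t ^ 2) with hm
  set B := Real.exp (2 * (u * ρ) + 64 * t ^ 2) with hB
  have hm0 : 0 < m := Real.exp_pos _
  have hB0 : 0 < B := Real.exp_pos _
  -- On `E` this is z ≤ (m/4B)z² + B/m, a completed square. Integrating gives m ≤ m/2 + m/4 +
  -- (B/m)μ(E), that is μ(E) ≥ m²/(4B) = exp(-56t²)/4.
  have hpt : ∀ x, ENNReal.ofReal (Real.exp (u * Q x)) ≤ ENNReal.ofReal (m / 2) +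
      (ENNReal.ofReal (m / (4 * B)) * ENNReal.ofReal (Real.exp (2 * u * Q x)) +
        E.indicator (fun _ => ENNReal.ofReal (B / m)) x) := by
    intro x
    by_cases hx : x ∈ E
    · rw [Set.indicator_of_mem hx, ← ENNReal.ofReal_mul (by positivity),
        ← ENNReal.ofReal_add (by positivity) (by positivity),
        ← ENNReal.ofReal_add (by positivity) (by positivity)]
      apply ENNReal.ofReal_le_ofReal
      have : Real.exp (2 * u * Q x) = Real.exp (u * Q x) ^ 2 := by
        rw [← Real.exp_nat_mul]; congr 1; push_cast; ring
      rw [this]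
      set z := Real.exp (u * Q x)
      have h2 : m / (4 * B) * z ^ 2 + B / m - z = (m * z - 2 * B) ^ 2 / (4 * B * m) := by
        field_simp
        ring
      have h3 : 0 ≤ (m * z - 2 * B) ^ 2 / (4 * B * m) := by positivity
      linarith
    · rw [Set.indicator_of_notMem hx]
      refine le_trans (ENNReal.ofReal_le_ofReal ?_) le_self_add
      have h1 : Q x - ρ ≤ t * σ := not_lt.1 hx
      have h2 : u * Q x ≤ u * ρ + 2 * t ^ 2 := by
        have := mul_le_mul_of_nonneg_left h1 hu0.le
        have h3 : u * (t * σ) = 2 * t ^ 2 := by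
          rw [mul_left_comm, huσ]; ring
        linarith [mul_sub u (Q x) ρ]
      have h3 : (2 : ℝ) ≤ Real.exp (2 * t ^ 2) := by
        have := Real.add_one_le_exp (2 * t ^ 2)
        nlinarith
      have h4 : m = Real.exp (u * ρ + 2 * t ^ 2) * Real.exp (2 * t ^ 2) := by
        rw [hm, ← Real.exp_add]; congr 1; ring
      have h5 := Real.exp_le_exp.2 h2
      have h6 := Real.exp_pos (u * ρ + 2 * t ^ 2)
      rw [h4]
      nlinarith
  have hexp : AEMeasurable (fun x => ENNReal.ofReal (m / (4 * B)) *
      ENNReal.ofReal (Real.exp (2 * u * Q x))) μ :=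
    ((Real.measurable_exp.comp_aemeasurable (hQm.const_mul (2 * u))).ennreal_ofReal).const_mul _
  have hI : ENNReal.ofReal m ≤ ENNReal.ofReal (m / 2) +
      (ENNReal.ofReal (m / 4) + ENNReal.ofReal (B / m) * μ E) := by
    calc ENNReal.ofReal m ≤ _ := hlow
      _ ≤ _ := lintegral_mono hpt
      _ ≤ _ := by
        rw [lintegral_add_left measurable_const, lintegral_add_left' hexp, lintegral_const,
          measure_univ, mul_one, lintegral_const_mul' _ _ ENNReal.ofReal_ne_top]
        gcongr
        · refine (mul_le_mul_right hup _).trans_eq ?_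
          rw [← ENNReal.ofReal_mul (by positivity)]
          congr 1
          field_simp
        · exact lintegral_indicator_const_le _ _
  have hfin : μ E ≠ ⊤ := measure_ne_top _ _
  rw [← ENNReal.ofReal_toReal hfin, ← ENNReal.ofReal_mul (by positivity),
    ← ENNReal.ofReal_add (by positivity) (by positivity),
    ← ENNReal.ofReal_add (by positivity) (by positivity),
    ENNReal.ofReal_le_ofReal_iff (by positivity)] at hI
  rw [← ENNReal.ofReal_toReal hfin]
  apply ENNReal.ofReal_le_ofReal
  have h7 : Real.exp (-(56 * t ^ 2)) = m * m / B := by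
    rw [hm, hB, ← Real.exp_add, ← Real.exp_sub]; congr 1; ring
  rw [h7]
  have h8 : m / 4 ≤ B / m * (μ E).toReal := by linarith
  have h9 := mul_le_mul_of_nonneg_left h8 (by positivity : 0 ≤ m / B)
  calc m * m / B / 4 = m / B * (m / 4) := by ring
    _ ≤ _ := h9
    _ = _ := by field_simp

end Tails

/-! ### Reduction of the test to quadratic forms, and bounds for its two error probabilities. -/

section Noise

variable {Ω : Type*} [MeasurableSpace Ω] {μ : Measure Ω} {W : L2 → Ω → ℝ}

/-- Uncorrelated jointly Gaussian variables are independent. The criterion concerns families of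
processes, so each variable is viewed as a process indexed by `Unit`. -/
theorem IsGaussianWhiteNoise.iIndepFun_basis (hW : IsGaussianWhiteNoise μ W)
    (b : HilbertBasis ℕ ℝ L2) : iIndepFun (fun j => W (b j)) μ := by
  have h1 : IsGaussianProcess (fun (p : (_ : ℕ) × Unit) x => W (b p.1) x) μ :=
    hW.gaussian.comp_right fun p : (_ : ℕ) × Unit => b p.1
  have h2 := IsGaussianProcess.iIndepFun_of_covariance_eq_zero (X := fun j (_ : Unit) => W (b j)) h1
    (fun j _ => hW.gaussian.aemeasurable (b j)) fun i j hij _ _ => by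
      rw [hW.covariance_eq]
      exact b.orthonormal.2 hij
  exact h2.comp (fun _ f => f ()) fun _ => measurable_pi_apply ()

theorem IsGaussianWhiteNoise.hasLaw_basis (hW : IsGaussianWhiteNoise μ W)
    (b : HilbertBasis ℕ ℝ L2) (j : ℕ) : HasLaw (W (b j)) (gaussianReal 0 1) μ where
  aemeasurable := hW.gaussian.aemeasurable (b j)
  map_eq := by
    rw [(hW.gaussian.hasGaussianLaw_eval (b j)).map_eq_gaussianReal, hW.mean_zero,
      ← covariance_self (hW.gaussian.aemeasurable (b j)), hW.covariance_eq,
      real_inner_self_eq_norm_sq, b.orthonormal.1 j]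
    simp

/-- The weights `ϰ²_{ε,j+1}`, numbered from `0`. -/
def weight (ϰ : ℝ → ℕ → ℝ) (ε : ℝ) (j : ℕ) : ℝ := ϰ ε (j + 1) ^ 2

/-- `(∑ ϰ⁴_{εj})^{1/2}`. -/
def weightNorm (ϰ : ℝ → ℕ → ℝ) (ε : ℝ) : ℝ := √(∑' j, weight ϰ ε j ^ 2)

/-- `ε⁻² ∑ ϰ²_{εj} θ_j²`, the shift of the mean of the test statistic. -/
def drift (b : HilbertBasis ℕ ℝ L2) (ϰ : ℝ → ℕ → ℝ) (ε : ℝ) (S : L2) : ℝ :=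
  ∑' j, weight ϰ ε j * (inner ℝ (b j) S / ε) ^ 2

variable {ϰ : ℝ → ℕ → ℝ} {ε : ℝ}

theorem weight_nonneg (ϰ : ℝ → ℕ → ℝ) (ε : ℝ) (j : ℕ) : 0 ≤ weight ϰ ε j := sq_nonneg _

theorem sqrt_bigA (hε : 0 < ε) : √(bigA ϰ ε) = weightNorm ϰ ε / ε ^ 2 := by
  have h1 : bigA ϰ ε = (∑' j, weight ϰ ε j ^ 2) / (ε ^ 2) ^ 2 := by
    rw [bigA, div_eq_inv_mul, ← pow_mul]
    simp only [weight, ← pow_mul]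
  rw [h1, Real.sqrt_div' _ (by positivity), Real.sqrt_sq (by positivity), weightNorm]

theorem WeightConditions.weightNorm_pos (hϰ : WeightConditions ϰ) (hε : 0 < ε) :
    0 < weightNorm ϰ ε := by
  obtain ⟨C₁, hC₁, C₂, -, h⟩ := hϰ.A2
  have h1 := Real.sqrt_pos.2 (hC₁.trans (h ε hε).1)
  rw [sqrt_bigA hε] at h1
  by_contra h2
  exact absurd h1 (not_lt.2 (div_nonpos_of_nonpos_of_nonneg (not_lt.1 h2) (by positivity)))

theorem WeightConditions.weight_antitone (hϰ : WeightConditions ϰ) (hε : 0 < ε) :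
    Antitone (weight ϰ ε) :=
  antitone_nat_of_succ_le fun j => hϰ.A1 ε hε (j + 1) (by omega)

theorem WeightConditions.summable_weight (hϰ : WeightConditions ϰ) (hε : 0 < ε) :
    Summable (weight ϰ ε) := hϰ.summable ε hε

theorem WeightConditions.summable_weight_sq (hϰ : WeightConditions ϰ) (hε : 0 < ε) :
    Summable fun j => weight ϰ ε j ^ 2 := by
  refine Summable.of_nonneg_of_le (fun _ => sq_nonneg _) (fun j => ?_)
    ((hϰ.summable_weight hε).mul_left (weight ϰ ε 0))
  rw [sq]
  exact mul_le_mul_of_nonneg_right (hϰ.weight_antitone hε (Nat.zero_le j)) (weight_nonneg _ _ _)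

theorem weightNorm_sq (ϰ : ℝ → ℕ → ℝ) (ε : ℝ) :
    ∑' j, weight ϰ ε j ^ 2 = weightNorm ϰ ε ^ 2 :=
  (Real.sq_sqrt (tsum_nonneg fun _ => sq_nonneg _)).symm

theorem hasSum_inner_sq (b : HilbertBasis ℕ ℝ L2) (S : L2) :
    HasSum (fun j => (inner ℝ (b j) S : ℝ) ^ 2) (‖S‖ ^ 2) := by
  have h := b.hasSum_inner_mul_inner S S
  rw [real_inner_self_eq_norm_sq] at h
  refine h.congr_fun fun j => ?_
  rw [real_inner_comm, sq]

theorem WeightConditions.summable_drift (hϰ : WeightConditions ϰ) (hε : 0 < ε)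
    (b : HilbertBasis ℕ ℝ L2) (S : L2) :
    Summable fun j => weight ϰ ε j * (inner ℝ (b j) S / ε) ^ 2 := by
  refine Summable.of_nonneg_of_le (fun _ => mul_nonneg (weight_nonneg _ _ _) (sq_nonneg _))
    (fun j => ?_) ((hasSum_inner_sq b S).summable.mul_left (weight ϰ ε 0 / ε ^ 2))
  rw [div_pow, div_mul_eq_mul_div, ← mul_div_assoc]
  gcongr
  exact hϰ.weight_antitone hε (Nat.zero_le j)

/-- Dividing the observations by ε leaves unit noise shifted by θ_j/ε. Since √A_ε = σ/ε², the
threshold in units of σ is t/ε². -/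
theorem sqrt_bigA_inv_mul_neymanStat_gt_iff {α : Type*} {W : L2 → α → ℝ}
    (hϰ : WeightConditions ϰ) (hε : 0 < ε) (b : HilbertBasis ℕ ℝ L2) (S : L2) (t : ℝ) (x : α) :
    (√(bigA ϰ ε))⁻¹ * neymanStat W b ϰ ε S x > t ↔
      t / ε ^ 2 * weightNorm ϰ ε <
        ∑' j, weight ϰ ε j * (W (b j) x + inner ℝ (b j) S / ε) ^ 2 - ∑' j, weight ϰ ε j := by
  have hσ := hϰ.weightNorm_pos hε
  have h1 : neymanStat W b ϰ ε S x =
      ∑' j, weight ϰ ε j * (W (b j) x + inner ℝ (b j) S / ε) ^ 2 - ∑' j, weight ϰ ε j := by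
    rw [neymanStat, rhoSq, ← tsum_mul_left]
    congr 1
    refine tsum_congr fun j => ?_
    simp only [weight, observation]
    field_simp
    ring
  rw [h1, sqrt_bigA hε, gt_iff_lt, lt_inv_mul_iff₀ (by positivity)]
  rw [div_mul_eq_mul_div, div_mul_eq_mul_div, mul_comm t]

theorem typeIError_eq (hϰ : WeightConditions ϰ) (hε : 0 < ε) (b : HilbertBasis ℕ ℝ L2) (t : ℝ) :
    typeIError μ W b ϰ ε t = μ {x | t / ε ^ 2 * weightNorm ϰ ε <
        ∑' j, weight ϰ ε j * W (b j) x ^ 2 - ∑' j, weight ϰ ε j} := by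
  rw [typeIError]
  congr 1
  ext x
  simpa using sqrt_bigA_inv_mul_neymanStat_gt_iff hϰ hε b 0 t x

theorem typeIIError_eq (hϰ : WeightConditions ϰ) (hε : 0 < ε) (b : HilbertBasis ℕ ℝ L2) (t : ℝ)
    (S : L2) :
    typeIIError μ W b ϰ ε t S = μ {x |
        ∑' j, weight ϰ ε j * (W (b j) x + inner ℝ (b j) S / ε) ^ 2 - ∑' j, weight ϰ ε j ≤
          t / ε ^ 2 * weightNorm ϰ ε} := by
  rw [typeIIError]
  congr 1
  ext x
  simp only [Set.mem_ofPred_eq]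
  rw [sqrt_bigA_inv_mul_neymanStat_gt_iff hϰ hε b S t x, not_lt]

theorem typeIError_le {t y : ℝ} (hW : IsGaussianWhiteNoise μ W) (hϰ : WeightConditions ϰ)
    (hε : 0 < ε) (b : HilbertBasis ℕ ℝ L2) (hy : 0 ≤ y) (hyt : y ≤ t / ε ^ 2)
    (hya : y * weight ϰ ε 0 ≤ weightNorm ϰ ε) :
    typeIError μ W b ϰ ε t ≤ ENNReal.ofReal (Real.exp (-(y ^ 2 / 16))) := by
  have hσ := hϰ.weightNorm_pos hε
  have h := measure_tsum_sq_gt_le (hW.iIndepFun_basis b) (hW.hasLaw_basis b) (h := fun _ => 0)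
    (weight_nonneg ϰ ε) (hϰ.summable_weight hε) (hϰ.summable_weight_sq hε) (by simp)
    -- This `u` minimises 4u²σ² - uyσ; the minimum is -y²/16.
    (u := y / 8 / weightNorm ϰ ε) (by positivity) (fun j => by
      rw [div_mul_eq_mul_div, div_le_iff₀ hσ]
      nlinarith [hϰ.weight_antitone hε (Nat.zero_le j)]) (y * weightNorm ϰ ε)
  simp only [add_zero] at h
  rw [typeIError_eq hϰ hε]
  refine (measure_mono fun x hx => ?_).trans (h.trans_eq ?_)
  · exact lt_of_le_of_lt (mul_le_mul_of_nonneg_right hyt hσ.le) hx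
  · rw [weightNorm_sq]
    congr 2
    simp only [ne_eq, OfNat.ofNat_ne_zero, not_false_eq_true, zero_pow, mul_zero, tsum_zero]
    field_simp
    ring

theorem typeIIError_le {t y : ℝ} {S : L2} (hW : IsGaussianWhiteNoise μ W)
    (hϰ : WeightConditions ϰ) (hε : 0 < ε) (b : HilbertBasis ℕ ℝ L2) (hy : 0 ≤ y)
    (hyt : t / ε ^ 2 ≤ y / 4) (hyD : y * weightNorm ϰ ε ≤ drift b ϰ ε S)
    (hya : y * weight ϰ ε 0 ≤ weightNorm ϰ ε) :
    typeIIError μ W b ϰ ε t S ≤ ENNReal.ofReal (Real.exp (-(y ^ 2 / 256))) := by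
  have hσ := hϰ.weightNorm_pos hε
  have h := measure_tsum_sq_le_le (hW.iIndepFun_basis b) (hW.hasLaw_basis b)
    (weight_nonneg ϰ ε) (hϰ.summable_weight hε) (hϰ.summable_weight_sq hε)
    (hϰ.summable_drift hε b S)
    -- Drift and threshold contribute at most -uyσ/2 + uyσ/4; this `u` minimises 4u²σ² - uyσ/4.
    (u := y / 32 / weightNorm ϰ ε) (by positivity) (fun j => by
      rw [div_mul_eq_mul_div, div_le_iff₀ hσ]
      nlinarith [hϰ.weight_antitone hε (Nat.zero_le j)]) (t / ε ^ 2 * weightNorm ϰ ε)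
  rw [typeIIError_eq hϰ hε]
  refine h.trans (ENNReal.ofReal_le_ofReal (Real.exp_le_exp.2 ?_))
  rw [weightNorm_sq]
  change 4 * _ * _ - _ * drift b ϰ ε S + _ ≤ _
  set σ := weightNorm ϰ ε
  have e1 : y / 32 / σ / 2 * (y * σ) ≤ y / 32 / σ / 2 * drift b ϰ ε S :=
    mul_le_mul_of_nonneg_left hyD (by positivity)
  have e2 : y / 32 / σ * (t / ε ^ 2 * σ) ≤ y / 32 / σ * (y / 4 * σ) := by gcongr
  have e3 : y / 32 / σ / 2 * (y * σ) = y ^ 2 / 64 := by field_simp; ring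
  have e4 : y / 32 / σ * (y / 4 * σ) = y ^ 2 / 128 := by field_simp; ring
  have e5 : 4 * (y / 32 / σ) ^ 2 * σ ^ 2 = y ^ 2 / 256 := by field_simp; ring
  linarith

theorem le_typeIError {t : ℝ} (hW : IsGaussianWhiteNoise μ W)
    (hϰ : WeightConditions ϰ) (hε : 0 < ε) (b : HilbertBasis ℕ ℝ L2) (ht : 1 ≤ t)
    (hta : 16 * t * weight ϰ ε 0 ≤ weightNorm ϰ ε) :
    ENNReal.ofReal (Real.exp (-(56 * t ^ 2)) / 4) ≤ typeIError μ W b ϰ ε (t * ε ^ 2) := by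
  rw [typeIError_eq hϰ hε, mul_div_cancel_right₀ _ (by positivity)]
  exact le_measure_tsum_sq_gt (hW.iIndepFun_basis b) (hW.hasLaw_basis b)
    (weight_nonneg ϰ ε) (hϰ.summable_weight hε) (hϰ.summable_weight_sq hε)
    (hϰ.weightNorm_pos hε) (weightNorm_sq ϰ ε) ht fun j => le_trans
      (mul_le_mul_of_nonneg_left (hϰ.weight_antitone hε (Nat.zero_le j)) (by linarith)) hta

/-- The threshold is chosen so that the Chernoff exponent at u = 1/σ, namely 4 + 2D/σ - t, equals
-1; and e⁻¹ < 1/2. -/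
theorem le_typeIIError {t : ℝ} {S : L2} (hW : IsGaussianWhiteNoise μ W)
    (hϰ : WeightConditions ϰ) (hε : 0 < ε) (b : HilbertBasis ℕ ℝ L2)
    (ht : t = 2 * (drift b ϰ ε S / weightNorm ϰ ε) + 5)
    (hta : 4 * weight ϰ ε 0 ≤ weightNorm ϰ ε) :
    ENNReal.ofReal (1 / 2) ≤ typeIIError μ W b ϰ ε (t * ε ^ 2) S := by
  have : IsProbabilityMeasure μ := (hW.iIndepFun_basis b).isProbabilityMeasure
  have hσ := hϰ.weightNorm_pos hε
  have h := measure_tsum_sq_gt_le (hW.iIndepFun_basis b) (hW.hasLaw_basis b)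
    (weight_nonneg ϰ ε) (hϰ.summable_weight hε) (hϰ.summable_weight_sq hε)
    (hϰ.summable_drift hε b S)
    (u := 1 / weightNorm ϰ ε) (by positivity) (fun j => by
      rw [div_mul_eq_mul_div, div_le_iff₀ hσ]
      nlinarith [hϰ.weight_antitone hε (Nat.zero_le j)]) (t * weightNorm ϰ ε)
  rw [typeIIError_eq hϰ hε, mul_div_cancel_right₀ _ (by positivity)]
  set Q : Ω → ℝ := fun x =>
    ∑' j, weight ϰ ε j * (W (b j) x + inner ℝ (b j) S / ε) ^ 2 - ∑' j, weight ϰ ε j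
  have h1 : μ {x | t * weightNorm ϰ ε < Q x} ≤ ENNReal.ofReal (1 / 2) := by
    refine h.trans (ENNReal.ofReal_le_ofReal ?_)
    rw [weightNorm_sq]
    change Real.exp (4 * _ * _ + _ * drift b ϰ ε S - _) ≤ _
    have e : 4 * (1 / weightNorm ϰ ε) ^ 2 * weightNorm ϰ ε ^ 2 +
        2 * (1 / weightNorm ϰ ε) * drift b ϰ ε S - 1 / weightNorm ϰ ε * (t * weightNorm ϰ ε) =
        -1 := by
      rw [ht]
      field_simp
      ring
    rw [e]
    exact Real.exp_neg_one_lt_half.le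
  have h2 : (1 : ENNReal) ≤
      μ {x | t * weightNorm ϰ ε < Q x} + μ {x | Q x ≤ t * weightNorm ϰ ε} := by
    rw [← measure_univ (μ := μ)]
    refine (measure_mono fun x _ => ?_).trans (measure_union_le _ _)
    exact lt_or_ge (t * weightNorm ϰ ε) (Q x)
  have h3 : ENNReal.ofReal (1 / 2) + ENNReal.ofReal (1 / 2) = 1 := by
    rw [← ENNReal.ofReal_add (by norm_num) (by norm_num)]; norm_num
  have h4 : ENNReal.ofReal (1 / 2) + ENNReal.ofReal (1 / 2) ≤
      ENNReal.ofReal (1 / 2) + μ {x | Q x ≤ t * weightNorm ϰ ε} := by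
    rw [h3]
    exact h2.trans (by gcongr)
  exact (ENNReal.add_le_add_iff_left ENNReal.ofReal_ne_top).1 h4

end Noise

/-! ### Consequences of A1–A4 for the weights and for k_ε. -/

section Weights

variable {ϰ : ℝ → ℕ → ℝ} {ε : ℝ}

theorem sum_Ico_one_eq_sum_weight (ϰ : ℝ → ℕ → ℝ) (ε : ℝ) (k : ℕ) :
    ∑ j ∈ Finset.Ico 1 k, ϰ ε j ^ 2 = ∑ j ∈ Finset.range (k - 1), weight ϰ ε j := by
  rw [Finset.sum_Ico_eq_sum_range]
  exact Finset.sum_congr rfl fun j _ => by rw [weight, add_comm]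

theorem WeightConditions.weightNorm_sq_le (hϰ : WeightConditions ϰ) (hε : 0 < ε) :
    weightNorm ϰ ε ^ 2 ≤ weight ϰ ε 0 * rhoSq ϰ ε := by
  rw [← weightNorm_sq, rhoSq, ← tsum_mul_left]
  refine (hϰ.summable_weight_sq hε).tsum_le_tsum (fun j => ?_)
    ((hϰ.summable_weight hε).mul_left _)
  rw [sq]
  exact mul_le_mul_of_nonneg_right (hϰ.weight_antitone hε (Nat.zero_le j)) (weight_nonneg _ _ _)

theorem WeightConditions.rhoSq_pos (hϰ : WeightConditions ϰ) (hε : 0 < ε) : 0 < rhoSq ϰ ε := by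
  have h1 : 0 < weightNorm ϰ ε ^ 2 := pow_pos (hϰ.weightNorm_pos hε) 2
  exact pos_of_mul_pos_right (h1.trans_le (hϰ.weightNorm_sq_le hε)) (weight_nonneg _ _ _)

theorem WeightConditions.one_le_kEps_and_rhoSq_lt (hϰ : WeightConditions ϰ) (hε : 0 < ε) :
    1 ≤ kEps ϰ ε ∧ rhoSq ϰ ε < 2 * ∑ j ∈ Finset.range (kEps ϰ ε), weight ϰ ε j := by
  have hρ := hϰ.rhoSq_pos hε
  set s := {k : ℕ | ∑ j ∈ Finset.Ico 1 k, ϰ ε j ^ 2 ≤ rhoSq ϰ ε / 2} with hs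
  have h1s : 1 ∈ s := by
    simp only [hs, Set.mem_ofPred_eq, Finset.Ico_self, Finset.sum_empty]
    positivity
  have hlim : Tendsto (fun N => ∑ j ∈ Finset.range N, weight ϰ ε j) atTop (𝓝 (rhoSq ϰ ε)) :=
    (hϰ.summable_weight hε).hasSum.tendsto_sum_nat
  obtain ⟨N, hN⟩ := (hlim.eventually (lt_mem_nhds (half_lt_self hρ))).exists
  -- Boundedness matters: `sSup` of an unbounded set of naturals is 0.
  have hbdd : BddAbove s := by
    refine ⟨N, fun k hk => ?_⟩
    by_contra hkN
    have hk' : ∑ j ∈ Finset.Ico 1 k, ϰ ε j ^ 2 ≤ rhoSq ϰ ε / 2 := hk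
    rw [sum_Ico_one_eq_sum_weight] at hk'
    have : ∑ j ∈ Finset.range N, weight ϰ ε j ≤ ∑ j ∈ Finset.range (k - 1), weight ϰ ε j :=
      Finset.sum_le_sum_of_subset_of_nonneg (Finset.range_mono (by omega))
        fun _ _ _ => weight_nonneg _ _ _
    linarith
  refine ⟨le_csSup hbdd h1s, ?_⟩
  by_contra hlt
  -- The sum over `Ico 1 k` has k - 1 terms, so k_ε + 1 tests exactly the first k_ε weights.
  have : kEps ϰ ε + 1 ∈ s := by
    simp only [hs, Set.mem_ofPred_eq, sum_Ico_one_eq_sum_weight, Nat.add_sub_cancel]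
    linarith [not_lt.1 hlt]
  have h3 : kEps ϰ ε + 1 ≤ kEps ϰ ε := le_csSup hbdd this
  omega

theorem WeightConditions.kEps_pos (hϰ : WeightConditions ϰ) (hε : 0 < ε) : 0 < kEps ϰ ε :=
  (hϰ.one_le_kEps_and_rhoSq_lt hε).1

theorem WeightConditions.kappaSq_eq (hϰ : WeightConditions ϰ) (hε : 0 < ε) :
    kappaSq ϰ ε = weight ϰ ε (kEps ϰ ε - 1) := by
  rw [kappaSq, weight, Nat.sub_add_cancel (hϰ.kEps_pos hε)]

theorem kappaSq_nonneg (ϰ : ℝ → ℕ → ℝ) (ε : ℝ) : 0 ≤ kappaSq ϰ ε := sq_nonneg _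

theorem WeightConditions.sqrt_kEps_mul_kappaSq_le (hϰ : WeightConditions ϰ) (hε : 0 < ε) :
    √(kEps ϰ ε) * kappaSq ϰ ε ≤ weightNorm ϰ ε := by
  apply Real.le_sqrt_of_sq_le
  rw [mul_pow, Real.sq_sqrt (Nat.cast_nonneg _)]
  calc (kEps ϰ ε : ℝ) * kappaSq ϰ ε ^ 2 = ∑ _j ∈ Finset.range (kEps ϰ ε), kappaSq ϰ ε ^ 2 := by simp
    _ ≤ ∑ j ∈ Finset.range (kEps ϰ ε), weight ϰ ε j ^ 2 := by
        refine Finset.sum_le_sum fun j hj => ?_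
        rw [hϰ.kappaSq_eq hε]
        have := Finset.mem_range.1 hj
        exact pow_le_pow_left₀ (weight_nonneg _ _ _) (hϰ.weight_antitone hε (by omega)) 2
    _ ≤ _ := (hϰ.summable_weight_sq hε).sum_le_tsum _ fun _ _ => sq_nonneg _

/-- Combine σ² ≤ a_1 ρ² with ρ² < 2 k_ε a_1: by definition of k_ε, half of the total weight lies in
the first k_ε terms. -/
theorem WeightConditions.weightNorm_le_sqrt_kEps_mul (hϰ : WeightConditions ϰ) (hε : 0 < ε) :
    weightNorm ϰ ε ≤ 2 * √(kEps ϰ ε) * weight ϰ ε 0 := by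
  have h1 := (hϰ.one_le_kEps_and_rhoSq_lt hε).2
  have h2 : ∑ j ∈ Finset.range (kEps ϰ ε), weight ϰ ε j ≤ kEps ϰ ε * weight ϰ ε 0 := by
    calc _ ≤ ∑ _j ∈ Finset.range (kEps ϰ ε), weight ϰ ε 0 :=
          Finset.sum_le_sum fun j _ => hϰ.weight_antitone hε (Nat.zero_le j)
      _ = _ := by simp
  have h3 := hϰ.weightNorm_sq_le hε
  have h0 := weight_nonneg ϰ ε 0
  refine abs_le_of_sq_le_sq' ?_ (by positivity) |>.2
  rw [mul_pow, mul_pow, Real.sq_sqrt (Nat.cast_nonneg _)]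
  have h4 : 0 ≤ (kEps ϰ ε : ℝ) * weight ϰ ε 0 ^ 2 := by positivity
  nlinarith

theorem WeightConditions.exists_weight_le (hϰ : WeightConditions ϰ) :
    ∃ C > 0, ∃ lam > (0 : ℝ), ∀ ε > 0, ∀ i : ℕ, kEps ϰ ε ≤ i →
      weight ϰ ε i ≤ C * ((i + 1 : ℝ) / kEps ϰ ε) ^ (-lam) * kappaSq ϰ ε := by
  obtain ⟨C, hC, lam, hlam, h⟩ := hϰ.A3
  refine ⟨C, hC, lam, by linarith, fun ε hε i hi => ?_⟩
  have hk : (0 : ℝ) < kEps ϰ ε := Nat.cast_pos.2 (hϰ.kEps_pos hε)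
  have hi' : (kEps ϰ ε : ℝ) ≤ i := Nat.cast_le.2 hi
  -- This δ makes (1 + δ)k_ε the integer i + 1, so the floor in A3 is harmless; k_ε ≤ i gives δ > 0.
  have h1 := h ((i + 1 : ℝ) / kEps ϰ ε - 1)
    (by rw [gt_iff_lt, sub_pos, one_lt_div hk]; linarith) ε hε
  rw [add_sub_cancel, div_mul_cancel₀ _ hk.ne',
    show (i : ℝ) + 1 = ((i + 1 : ℕ) : ℝ) by push_cast; rfl,
    Nat.floor_natCast] at h1
  push_cast at h1
  exact h1.le

theorem WeightConditions.exists_le_weight (hϰ : WeightConditions ϰ) {c : ℝ} (hc : 1 < c) :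
    ∃ C > 0, ∀ ε > 0, ∀ j : ℕ, (j : ℝ) + 1 ≤ c * kEps ϰ ε → C * kappaSq ϰ ε ≤ weight ϰ ε j := by
  obtain ⟨C, hC, h⟩ := hϰ.A4 c hc
  refine ⟨C, hC, fun ε hε j hj => (h ε hε).trans ?_⟩
  have h1 : j + 1 ≤ ⌊c * (kEps ϰ ε : ℝ)⌋₊ := Nat.le_floor (by push_cast; exact hj)
  have h2 := hϰ.weight_antitone hε (show j ≤ ⌊c * (kEps ϰ ε : ℝ)⌋₊ - 1 by omega)
  rwa [weight, Nat.sub_add_cancel (by omega)] at h2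

end Weights

/-! ### Besov balls: residuals, compactness, span and greedy system. -/

section Geometry

variable (b : HilbertBasis ℕ ℝ L2) {c : ℕ → ℝ}

/-- The residual map `S ↦ S̃_i` as a continuous linear map. -/
def residualMap (e : ℕ → L2) (i : ℕ) : L2 →L[ℝ] L2 :=
  ContinuousLinearMap.id ℝ L2 - (greedySpan e i).starProjection

theorem residualMap_apply (e : ℕ → L2) (i : ℕ) (S : L2) :
    residualMap e i S = greedyResidual e S i := rfl

/-- Nonzero scalings do not change Π_i. Keeping `c` general serves both the plain basis (c = 1) and
the greedy system. -/
theorem inner_greedyResidual (hc : ∀ i, c i ≠ 0) (S : L2) (i j : ℕ) :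
    inner ℝ (b j) (greedyResidual (fun i => c i • b i) S i) =
      if i ≤ j then (inner ℝ (b j) S : ℝ) else 0 := by
  set e : ℕ → L2 := fun i => c i • b i with he
  split_ifs with hij
  · have h1 : greedySpan e i ≤ (ℝ ∙ b j)ᗮ := by
      refine Submodule.span_le.2 ?_
      rintro _ ⟨k, rfl⟩
      rw [SetLike.mem_coe, Submodule.mem_orthogonal_singleton_iff_inner_right]
      simp only [he, inner_smul_right]
      rw [b.orthonormal.2 (by omega : j ≠ (k : ℕ)), mul_zero]
    have h2 := h1 ((greedySpan e i).starProjection_apply_mem S)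
    rw [Submodule.mem_orthogonal_singleton_iff_inner_right] at h2
    rw [greedyResidual, inner_sub_right, h2, sub_zero]
  · have h1 : b j ∈ greedySpan e i := by
      have h2 : e j ∈ greedySpan e i := Submodule.subset_span ⟨⟨j, not_le.1 hij⟩, rfl⟩
      have h3 := Submodule.smul_mem _ (c j)⁻¹ h2
      rwa [he, smul_smul, inv_mul_cancel₀ (hc j), one_smul] at h3
    rw [greedyResidual, real_inner_comm]
    exact Submodule.starProjection_inner_eq_zero S (b j) h1

theorem hasSum_greedyResidual (hc : ∀ i, c i ≠ 0) (S : L2) (i : ℕ) :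
    HasSum (fun j => if i ≤ j then (inner ℝ (b j) S : ℝ) ^ 2 else 0)
      (‖greedyResidual (fun i => c i • b i) S i‖ ^ 2) := by
  refine (hasSum_inner_sq b _).congr_fun fun j => ?_
  rw [inner_greedyResidual b hc]
  split_ifs <;> simp

theorem norm_greedyResidual_zero (hc : ∀ i, c i ≠ 0) (S : L2) :
    ‖greedyResidual (fun i => c i • b i) S 0‖ = ‖S‖ := by
  have h := hasSum_greedyResidual b hc S 0
  simp only [Nat.zero_le, if_true] at h
  exact (sq_eq_sq₀ (norm_nonneg _) (norm_nonneg _)).1 (h.unique (hasSum_inner_sq b S))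

theorem infDist_greedySpan (e : ℕ → L2) (S : L2) (i : ℕ) :
    Metric.infDist S (greedySpan e i : Set L2) = ‖greedyResidual e S i‖ := by
  rw [greedyResidual, Submodule.starProjection_minimal, Metric.infDist_eq_iInf]
  simp only [dist_eq_norm]
  rfl

theorem tsum_tail_eq (hc : ∀ i, c i ≠ 0) (S : L2) {lam : ℝ} (hlam : 0 < lam) :
    ∑' j : ℕ, (if lam < (j : ℝ) + 1 then (inner ℝ (b j) S : ℝ) ^ 2 else 0) =
      ‖greedyResidual (fun i => c i • b i) S ⌊lam⌋₊‖ ^ 2 := by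
  rw [← (hasSum_greedyResidual b hc S ⌊lam⌋₊).tsum_eq]
  refine tsum_congr fun j => ?_
  have : lam < (j : ℝ) + 1 ↔ ⌊lam⌋₊ ≤ j := by
    rw [← Nat.lt_add_one_iff, Nat.floor_lt hlam.le]
    push_cast
    rfl
  simp only [this]

/-- The tail is constant for λ in [i, i+1), so the supremum there is the left limit at i + 1; hence
the factor (i+1)^(2s) rather than i^(2s). -/
theorem mem_besovBall_iff (hc : ∀ i, c i ≠ 0) {s P : ℝ} (hs : 0 < s) {S : L2} :
    S ∈ besovBall b s P ↔ ∀ i : ℕ,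
      ((i : ℝ) + 1) ^ (2 * s) * ‖greedyResidual (fun i => c i • b i) S i‖ ^ 2 ≤ P := by
  constructor
  · intro h i
    have hcont : ContinuousAt (fun lam : ℝ =>
        lam ^ (2 * s) * ‖greedyResidual (fun i => c i • b i) S i‖ ^ 2) ((i : ℝ) + 1) :=
      (Real.continuousAt_rpow_const _ _ (Or.inr (by linarith))).mul continuousAt_const
    refine le_of_tendsto (hcont.tendsto.mono_left nhdsWithin_le_nhds :
      Tendsto _ (𝓝[<] ((i : ℝ) + 1)) _) ?_
    filter_upwards [Ioo_mem_nhdsLT (show (i : ℝ) < i + 1 by linarith)] with lam hl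
    have hl0 : 0 < lam := (Nat.cast_nonneg i).trans_lt hl.1
    have h1 := h lam hl0
    rw [tsum_tail_eq b hc S hl0, (Nat.floor_eq_iff hl0.le).2 ⟨hl.1.le, hl.2⟩] at h1
    exact h1
  · intro h lam hlam
    rw [tsum_tail_eq b hc S hlam]
    refine le_trans (mul_le_mul_of_nonneg_right ?_ (sq_nonneg _)) (h ⌊lam⌋₊)
    exact Real.rpow_le_rpow hlam.le (Nat.lt_floor_add_one lam).le (by linarith)

theorem mem_besovBall_iff_norm_le (hc : ∀ i, c i ≠ 0) {s P : ℝ} (hs : 0 < s) (hP : 0 ≤ P)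
    {S : L2} : S ∈ besovBall b s P ↔ ∀ i : ℕ,
      ‖greedyResidual (fun i => c i • b i) S i‖ ≤ √P * ((i : ℝ) + 1) ^ (-s) := by
  rw [mem_besovBall_iff b hc hs]
  refine forall_congr' fun i => ?_
  have hi : (0 : ℝ) < (i : ℝ) + 1 := by positivity
  have hp : 0 < ((i : ℝ) + 1) ^ s := Real.rpow_pos_of_pos hi s
  rw [Real.rpow_neg hi.le, ← div_eq_mul_inv, le_div_iff₀ hp, Real.le_sqrt (by positivity) hP,
    mul_pow, two_mul, Real.rpow_add hi, ← sq, mul_comm]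

/-- Displays the ball as an intersection of linear preimages of closed balls, from which convexity
and closedness are immediate. -/
theorem besovBall_eq_iInter {s P : ℝ} (hs : 0 < s) (hP : 0 ≤ P) :
    besovBall b s P = ⋂ i : ℕ, residualMap (fun i => (1 : ℝ) • b i) i ⁻¹'
      Metric.closedBall 0 (√P * ((i : ℝ) + 1) ^ (-s)) := by
  ext S
  rw [mem_besovBall_iff_norm_le b (c := fun _ => 1) (fun _ => one_ne_zero) hs hP]
  simp [residualMap_apply]

theorem convex_besovBall {s P : ℝ} (hs : 0 < s) (hP : 0 ≤ P) : Convex ℝ (besovBall b s P) := by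
  rw [besovBall_eq_iInter b hs hP]
  exact convex_iInter fun i => (convex_closedBall _ _).linear_preimage (residualMap _ i).toLinearMap

theorem neg_mem_besovBall {s P : ℝ} {S : L2} (hS : S ∈ besovBall b s P) :
    -S ∈ besovBall b s P := by
  intro lam hlam
  simpa using hS lam hlam

theorem isClosed_besovBall {s P : ℝ} (hs : 0 < s) (hP : 0 ≤ P) : IsClosed (besovBall b s P) := by
  rw [besovBall_eq_iInter b hs hP]
  exact isClosed_iInter fun i => Metric.isClosed_closedBall.preimage (residualMap _ i).continuous

/-- Residuals tend to 0 uniformly on the ball, so it lies within δ/2 of a bounded set in a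
finite-dimensional Π_i and is totally bounded. -/
theorem isCompact_besovBall {s P : ℝ} (hs : 0 < s) (hP : 0 ≤ P) : IsCompact (besovBall b s P) := by
  refine isCompact_iff_totallyBounded_isComplete.2 ⟨?_, (isClosed_besovBall b hs hP).isComplete⟩
  refine Metric.totallyBounded_iff.2 fun δ hδ => ?_
  set e : ℕ → L2 := fun i => (1 : ℝ) • b i with he
  have hlim : Tendsto (fun i : ℕ => √P * ((i : ℝ) + 1) ^ (-s)) atTop (𝓝 (√P * 0)) :=
    ((tendsto_rpow_neg_atTop hs).comp
      (tendsto_atTop_add_const_right _ _ tendsto_natCast_atTop_atTop)).const_mul _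
  rw [mul_zero] at hlim
  obtain ⟨i, hi⟩ := (hlim.eventually (gt_mem_nhds (half_pos hδ))).exists
  have hK : IsCompact ((greedySpan e i).subtypeL '' Metric.closedBall 0 (√P)) :=
    (isCompact_closedBall _ _).image (greedySpan e i).subtypeL.continuous
  obtain ⟨t, htf, ht⟩ := Metric.totallyBounded_iff.1 hK.totallyBounded (δ / 2) (half_pos hδ)
  refine ⟨t, htf, fun S hS => ?_⟩
  rw [mem_besovBall_iff_norm_le b (c := fun _ => 1) (fun _ => one_ne_zero) hs hP] at hS
  have hn : ‖S‖ ≤ √P := by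
    have := hS 0
    rwa [norm_greedyResidual_zero b (fun _ => one_ne_zero), Nat.cast_zero, zero_add,
      Real.one_rpow, mul_one] at this
  have hmem : (greedySpan e i).starProjection S ∈
      (greedySpan e i).subtypeL '' Metric.closedBall 0 (√P) := by
    refine ⟨⟨_, (greedySpan e i).starProjection_apply_mem S⟩, ?_, rfl⟩
    rw [mem_closedBall_zero_iff]
    exact ((greedySpan e i).norm_starProjection_apply_le S).trans hn
  obtain ⟨y, hy, hSy⟩ := Set.mem_iUnion₂.1 (ht hmem)
  refine Set.mem_iUnion₂.2 ⟨y, hy, ?_⟩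
  rw [Metric.mem_ball] at hSy ⊢
  have h1 : dist S ((greedySpan e i).starProjection S) < δ / 2 := by
    rw [dist_eq_norm]
    exact (hS i).trans_lt hi
  linarith [dist_triangle S ((greedySpan e i).starProjection S) y]

theorem span_besovBall {s P : ℝ} (hs : 0 < s) (hP : 0 < P) :
    (Submodule.span ℝ (besovBall b s P) : Set L2) = besovSpace b s := by
  have hc : ∀ i : ℕ, (fun _ => 1 : ℕ → ℝ) i ≠ 0 := fun _ => one_ne_zero
  refine Set.Subset.antisymm (fun S hS => ?_) ?_
  · rw [SetLike.mem_coe] at hS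
    induction hS using Submodule.span_induction with
    | mem x hx => exact ⟨P, hx⟩
    | zero => exact ⟨0, fun lam _ => by simp⟩
    | add x y _ _ hx hy =>
      obtain ⟨p, hx⟩ := hx
      obtain ⟨q, hy⟩ := hy
      refine ⟨2 * p + 2 * q, (mem_besovBall_iff b hc hs).2 fun i => ?_⟩
      have h1 := (mem_besovBall_iff b hc hs).1 hx i
      have h2 := (mem_besovBall_iff b hc hs).1 hy i
      simp only [← residualMap_apply, map_add] at h1 h2 ⊢
      set u := residualMap (fun i => (fun _ => 1 : ℕ → ℝ) i • b i) i x
      set v := residualMap (fun i => (fun _ => 1 : ℕ → ℝ) i • b i) i y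
      have h3 : ‖u + v‖ ^ 2 ≤ 2 * ‖u‖ ^ 2 + 2 * ‖v‖ ^ 2 := by
        have := pow_le_pow_left₀ (norm_nonneg _) (norm_add_le u v) 2
        nlinarith [sq_nonneg (‖u‖ - ‖v‖)]
      have h4 : 0 ≤ ((i : ℝ) + 1) ^ (2 * s) := by positivity
      nlinarith [mul_le_mul_of_nonneg_left h3 h4]
    | smul k x _ hx =>
      obtain ⟨p, hx⟩ := hx
      refine ⟨k ^ 2 * p, (mem_besovBall_iff b hc hs).2 fun i => ?_⟩
      have h1 := (mem_besovBall_iff b hc hs).1 hx i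
      simp only [← residualMap_apply, map_smul, norm_smul, mul_pow, Real.norm_eq_abs,
        sq_abs] at h1 ⊢
      calc _ = k ^ 2 * _ := by ring
        _ ≤ _ := mul_le_mul_of_nonneg_left h1 (sq_nonneg k)
  · rintro S ⟨p, hp⟩
    have hp0 : 0 ≤ p := le_trans (by positivity) ((mem_besovBall_iff b hc hs).1 hp 0)
    -- Rescales `S` into the ball of radius parameter `P`; p + 1 allows p = 0.
    set k := √(P / (p + 1)) with hk
    have hk0 : 0 < k := Real.sqrt_pos.2 (by positivity)
    have h2 : k • S ∈ besovBall b s P := by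
      refine (mem_besovBall_iff b hc hs).2 fun i => ?_
      have h1 := (mem_besovBall_iff b hc hs).1 hp i
      simp only [← residualMap_apply, map_smul, norm_smul, mul_pow, Real.norm_eq_abs,
        sq_abs] at h1 ⊢
      calc _ = k ^ 2 * _ := by ring
        _ ≤ k ^ 2 * p := mul_le_mul_of_nonneg_left h1 (sq_nonneg k)
        _ = P * (p / (p + 1)) := by rw [hk, Real.sq_sqrt (by positivity)]; ring
        _ ≤ P * 1 := by
          gcongr
          rw [div_le_one (by positivity)]
          linarith
        _ = P := mul_one P
    have h3 := Submodule.smul_mem _ k⁻¹ (Submodule.subset_span (R := ℝ) h2)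
    rwa [smul_smul, inv_mul_cancel₀ hk0.ne', one_smul] at h3

theorem besov_coeff_ne_zero {s P : ℝ} (hP : 0 < P) (i : ℕ) : √P * ((i : ℝ) + 1) ^ (-s) ≠ 0 := by
  positivity

theorem norm_greedyResidual_basis (hc : ∀ i, c i ≠ 0) (i k : ℕ) :
    ‖greedyResidual (fun i => c i • b i) (c k • b k) i‖ = if i ≤ k then |c k| else 0 := by
  have h1 : HasSum (fun j => if i ≤ j then (inner ℝ (b j) (c k • b k) : ℝ) ^ 2 else 0)
      (if i ≤ k then c k ^ 2 else 0) := by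
    have h2 : (if i ≤ k then c k ^ 2 else 0) =
        if i ≤ k then (inner ℝ (b k) (c k • b k) : ℝ) ^ 2 else 0 := by
      rw [inner_smul_right, real_inner_self_eq_norm_sq, b.orthonormal.1 k]
      simp
    rw [h2]
    refine hasSum_single k fun j hj => ?_
    rw [inner_smul_right, b.orthonormal.2 hj]
    simp
  have h3 := (hasSum_greedyResidual b hc (c k • b k) i).unique h1
  rw [← Real.sqrt_sq (norm_nonneg (greedyResidual _ _ _)), h3]
  split_ifs
  · exact Real.sqrt_sq_eq_abs _
  · exact Real.sqrt_zero

/-- The residual bounds defining the ball are exactly the distances of the scaled basis vectors from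
the preceding spans. -/
theorem isGreedySystem_besovBall {s P : ℝ} (hs : 0 < s) (hP : 0 < P) :
    IsGreedySystem (besovBall b s P) (fun i => (√P * ((i : ℝ) + 1) ^ (-s)) • b i) := by
  have hc : ∀ i : ℕ, √P * ((i : ℝ) + 1) ^ (-s) ≠ 0 := besov_coeff_ne_zero hP
  intro k
  have hres := norm_greedyResidual_basis b hc
  refine ⟨?_, fun S hS => ?_⟩
  · refine (mem_besovBall_iff_norm_le b hc hs hP.le).2 fun i => ?_
    rw [hres i k]
    split_ifs with hik
    · rw [abs_of_nonneg (by positivity)]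
      have : (i : ℝ) ≤ k := Nat.cast_le.2 hik
      exact mul_le_mul_of_nonneg_left (Real.rpow_le_rpow_of_nonpos (by positivity)
        (by linarith) (by linarith)) (Real.sqrt_nonneg P)
    · positivity
  · rw [infDist_greedySpan, infDist_greedySpan, hres k k, if_pos le_rfl,
      abs_of_nonneg (by positivity)]
    exact (mem_besovBall_iff_norm_le b hc hs hP.le).1 hS k

end Geometry

/-! ### Orders in ε: ϰ_ε² ≍ ε^q σ when k_ε ≍ ε^(-2q). -/

section Rates

variable {ϰ : ℝ → ℕ → ℝ} {q : ℝ}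

theorem tendsto_rpow_nhdsGT_zero {y : ℝ} (hy : 0 < y) :
    Tendsto (fun ε : ℝ => ε ^ y) (𝓝[>] 0) (𝓝 0) := by
  have h : ContinuousAt (fun ε : ℝ => ε ^ y) 0 := Real.continuousAt_rpow_const _ _ (Or.inr hy.le)
  simpa [Real.zero_rpow hy.ne'] using h.tendsto.mono_left nhdsWithin_le_nhds

theorem exists_kEps_le
    (hk : (fun ε => (kEps ϰ ε : ℝ)) =Θ[𝓝[>] 0] (fun ε : ℝ => ε ^ (-(2 * q)))) :
    ∃ K > 0, ∀ᶠ ε in 𝓝[>] (0 : ℝ), (kEps ϰ ε : ℝ) ≤ K * ε ^ (-(2 * q)) := by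
  obtain ⟨K, hK, h⟩ := hk.1.exists_pos
  refine ⟨K, hK, ?_⟩
  filter_upwards [h.bound, self_mem_nhdsWithin] with ε h1 hε
  have hε : 0 < ε := hε
  rwa [Real.norm_of_nonneg (by positivity), Real.norm_of_nonneg (by positivity)] at h1

theorem exists_le_kEps
    (hk : (fun ε => (kEps ϰ ε : ℝ)) =Θ[𝓝[>] 0] (fun ε : ℝ => ε ^ (-(2 * q)))) :
    ∃ K > 0, ∀ᶠ ε in 𝓝[>] (0 : ℝ), ε ^ (-(2 * q)) ≤ K * kEps ϰ ε := by
  obtain ⟨K, hK, h⟩ := hk.2.exists_pos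
  refine ⟨K, hK, ?_⟩
  filter_upwards [h.bound, self_mem_nhdsWithin] with ε h1 hε
  have hε : 0 < ε := hε
  rwa [Real.norm_of_nonneg (by positivity), Real.norm_of_nonneg (by positivity)] at h1

theorem WeightConditions.exists_weight_zero_le (hϰ : WeightConditions ϰ) :
    ∃ K > 0, ∀ᶠ ε in 𝓝[>] (0 : ℝ), weight ϰ ε 0 ≤ K * kappaSq ϰ ε := by
  obtain ⟨K, hK, h⟩ := hϰ.A4_first.1.exists_pos
  refine ⟨K, hK, ?_⟩
  filter_upwards [h.bound] with ε h1
  rwa [Real.norm_of_nonneg (sq_nonneg _), Real.norm_of_nonneg (kappaSq_nonneg ϰ ε)] at h1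

/-- From √k_ε ϰ_ε² ≤ σ and √k_ε ≳ ε^(-q). -/
theorem WeightConditions.exists_kappaSq_le (hϰ : WeightConditions ϰ)
    (hk : (fun ε => (kEps ϰ ε : ℝ)) =Θ[𝓝[>] 0] (fun ε : ℝ => ε ^ (-(2 * q)))) :
    ∃ K > 0, ∀ᶠ ε in 𝓝[>] (0 : ℝ), kappaSq ϰ ε ≤ K * ε ^ q * weightNorm ϰ ε := by
  obtain ⟨K, hK, h⟩ := exists_le_kEps hk
  refine ⟨√K, Real.sqrt_pos.2 hK, ?_⟩
  filter_upwards [h, self_mem_nhdsWithin] with ε h1 hε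
  have hε : 0 < ε := hε
  have h2 : ε ^ (-q) ≤ √K * √(kEps ϰ ε) := by
    rw [← Real.sqrt_mul hK.le]
    apply Real.le_sqrt_of_sq_le
    rw [← Real.rpow_natCast, ← Real.rpow_mul hε.le]
    convert h1 using 2
    push_cast
    ring
  have h3 : ε ^ q * ε ^ (-q) = 1 := by rw [← Real.rpow_add hε, add_neg_cancel, Real.rpow_zero]
  calc kappaSq ϰ ε = ε ^ q * ε ^ (-q) * kappaSq ϰ ε := by rw [h3, one_mul]
    _ ≤ ε ^ q * (√K * √(kEps ϰ ε)) * kappaSq ϰ ε := by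
        have := kappaSq_nonneg ϰ ε
        gcongr
    _ = √K * ε ^ q * (√(kEps ϰ ε) * kappaSq ϰ ε) := by ring
    _ ≤ _ := by
        have := hϰ.sqrt_kEps_mul_kappaSq_le hε
        gcongr

theorem WeightConditions.exists_weight_zero_le_weightNorm (hϰ : WeightConditions ϰ)
    (hk : (fun ε => (kEps ϰ ε : ℝ)) =Θ[𝓝[>] 0] (fun ε : ℝ => ε ^ (-(2 * q)))) :
    ∃ K > 0, ∀ᶠ ε in 𝓝[>] (0 : ℝ), weight ϰ ε 0 ≤ K * ε ^ q * weightNorm ϰ ε := by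
  obtain ⟨K₁, hK₁, h₁⟩ := hϰ.exists_weight_zero_le
  obtain ⟨K₂, hK₂, h₂⟩ := hϰ.exists_kappaSq_le hk
  refine ⟨K₁ * K₂, by positivity, ?_⟩
  filter_upwards [h₁, h₂] with ε h1 h2
  calc _ ≤ _ := h1
    _ ≤ _ := mul_le_mul_of_nonneg_left h2 hK₁.le
    _ = _ := by ring

theorem WeightConditions.exists_weightNorm_le (hϰ : WeightConditions ϰ)
    (hk : (fun ε => (kEps ϰ ε : ℝ)) =Θ[𝓝[>] 0] (fun ε : ℝ => ε ^ (-(2 * q)))) :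
    ∃ K > 0, ∀ᶠ ε in 𝓝[>] (0 : ℝ), ε ^ q * weightNorm ϰ ε ≤ K * kappaSq ϰ ε := by
  obtain ⟨K₁, hK₁, h₁⟩ := hϰ.exists_weight_zero_le
  obtain ⟨K₂, hK₂, h₂⟩ := exists_kEps_le hk
  refine ⟨2 * √K₂ * K₁, by positivity, ?_⟩
  filter_upwards [h₁, h₂, self_mem_nhdsWithin] with ε h1 h2 hε
  have hε : 0 < ε := hε
  have h3 : ε ^ q * √(kEps ϰ ε) ≤ √K₂ := by
    have h4 : √(kEps ϰ ε) ≤ √K₂ * ε ^ (-q) := by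
      rw [Real.sqrt_le_left (by positivity), mul_pow, Real.sq_sqrt hK₂.le, ← Real.rpow_natCast,
        ← Real.rpow_mul hε.le]
      convert h2 using 3
      push_cast
      ring
    calc _ ≤ ε ^ q * (√K₂ * ε ^ (-q)) := by gcongr
      _ = √K₂ * (ε ^ q * ε ^ (-q)) := by ring
      _ = √K₂ := by rw [← Real.rpow_add hε, add_neg_cancel, Real.rpow_zero, mul_one]
  calc ε ^ q * weightNorm ϰ ε ≤ ε ^ q * (2 * √(kEps ϰ ε) * weight ϰ ε 0) := by
        have := hϰ.weightNorm_le_sqrt_kEps_mul hε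
        gcongr
    _ = 2 * (ε ^ q * √(kEps ϰ ε)) * weight ϰ ε 0 := by ring
    _ ≤ 2 * √K₂ * (K₁ * kappaSq ϰ ε) := by
        have := weight_nonneg ϰ ε 0
        gcongr
    _ = _ := by ring

end Rates

/-! ### Bounds on the drift by residual norms. -/

section Drift

variable {ϰ : ℝ → ℕ → ℝ} {ε : ℝ} {c : ℕ → ℝ}

theorem WeightConditions.le_drift (hϰ : WeightConditions ϰ) (hε : 0 < ε)
    (b : HilbertBasis ℕ ℝ L2) (hc : ∀ i, c i ≠ 0) (S : L2) {i : ℕ} {A : ℝ}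
    (hA : ∀ j < i, A ≤ weight ϰ ε j) :
    A / ε ^ 2 * (‖S‖ ^ 2 - ‖greedyResidual (fun i => c i • b i) S i‖ ^ 2) ≤ drift b ϰ ε S := by
  have h1 := ((hasSum_inner_sq b S).sub (hasSum_greedyResidual b hc S i)).mul_left (A / ε ^ 2)
  refine hasSum_le (fun j => ?_) h1 (hϰ.summable_drift hε b S).hasSum
  split_ifs with hij
  · simpa using mul_nonneg (weight_nonneg ϰ ε j) (sq_nonneg _)
  · rw [sub_zero, div_pow, div_mul_eq_mul_div, ← mul_div_assoc]
    have := hA j (not_le.1 hij)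
    gcongr

theorem WeightConditions.drift_greedyResidual_le (hϰ : WeightConditions ϰ) (hε : 0 < ε)
    (b : HilbertBasis ℕ ℝ L2) (hc : ∀ i, c i ≠ 0) (S : L2) (i : ℕ) :
    drift b ϰ ε (greedyResidual (fun i => c i • b i) S i) ≤
      weight ϰ ε i / ε ^ 2 * ‖greedyResidual (fun i => c i • b i) S i‖ ^ 2 := by
  refine hasSum_le (fun j => ?_) (hϰ.summable_drift hε b _).hasSum
    ((hasSum_greedyResidual b hc S i).mul_left _)
  rw [inner_greedyResidual b hc]
  split_ifs with hij
  · rw [div_pow, div_mul_eq_mul_div, ← mul_div_assoc]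
    have := hϰ.weight_antitone hε hij
    gcongr
  · simp

theorem drift_nonneg (b : HilbertBasis ℕ ℝ L2) (ϰ : ℝ → ℕ → ℝ) (ε : ℝ) (S : L2) :
    0 ≤ drift b ϰ ε S :=
  tsum_nonneg fun _ => mul_nonneg (weight_nonneg _ _ _) (sq_nonneg _)

end Drift

/-! ### Property (i): consistency on the ball. -/

section Consistency

theorem ofReal_le_abs_of_le_neg {x : EReal} {a : ℝ} (h : x ≤ ((-a : ℝ) : EReal)) :
    ENNReal.ofReal a ≤ x.abs := by
  induction x with
  | bot => simp
  | top => simp at h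
  | coe x =>
    rw [EReal.abs_def]
    refine ENNReal.ofReal_le_ofReal ?_
    have := EReal.coe_le_coe_iff.1 h
    exact le_trans (by linarith) (neg_le_abs x)

theorem log_le_of_le_ofReal_exp {x : ENNReal} {a : ℝ} (h : x ≤ ENNReal.ofReal (Real.exp a)) :
    ENNReal.log x ≤ (a : EReal) := by
  refine (ENNReal.log_le_log h).trans_eq ?_
  rw [ENNReal.log_ofReal_of_pos (Real.exp_pos a), Real.log_exp]

variable {Ω : Type*} [MeasurableSpace Ω] {μ : Measure Ω} {W : L2 → Ω → ℝ} {ϰ : ℝ → ℕ → ℝ}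

/-- Alternatives whose drift is of the order `R σ_ε` are LD consistent with rate `R`. -/
theorem isLDConsistent_of_le_drift (hW : IsGaussianWhiteNoise μ W) (hϰ : WeightConditions ϰ)
    (b : HilbertBasis ℕ ℝ L2) {ι : Type*} {l : Filter ι} {ε : ι → ℝ} {S : ι → L2} {R : ι → ℝ}
    (hε : ∀ᶠ i in l, 0 < ε i) (hR : ∀ᶠ i in l, 0 < R i) {c : ℝ} (hc : 0 < c)
    (hD : ∀ᶠ i in l, c * R i * weightNorm ϰ (ε i) ≤ drift b ϰ (ε i) (S i))
    (ha : ∀ᶠ i in l, c * R i * weight ϰ (ε i) 0 ≤ weightNorm ϰ (ε i)) :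
    IsLDConsistent μ W b ϰ l ε S R := by
  intro t ht
  have hneg : ((-(c ^ 2 / 256) : ℝ) : EReal) < 0 := by
    rw [← EReal.coe_zero, EReal.coe_lt_coe_iff]
    have : 0 < c ^ 2 / 256 := by positivity
    linarith
  refine ⟨256 / c ^ 2, by positivity, ?_⟩
  filter_upwards [hε, hR, hD, ha, ht.eventually (lt_mem_nhds hneg)] with i hε hR hD ha hlog
  have hy : 0 < c * R i := by positivity
  -- A larger threshold would give R⁻² log α ≤ -(c/4)²/16 = -c²/256, contradicting the convergence
  -- to 0.
  have hti : t i / ε i ^ 2 ≤ c * R i / 4 := by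
    by_contra hcon
    have h1 := typeIError_le hW hϰ hε b (y := c * R i / 4) (by positivity) (not_le.1 hcon).le
      (le_trans (by nlinarith [mul_nonneg hy.le (weight_nonneg ϰ (ε i) 0)]) ha)
    have h2 : (((R i ^ 2)⁻¹ : ℝ) : EReal) * ENNReal.log (typeIError μ W b ϰ (ε i) (t i)) ≤
        (((R i ^ 2)⁻¹ : ℝ) : EReal) * ((-((c * R i / 4) ^ 2 / 16) : ℝ) : EReal) :=
      mul_le_mul_of_nonneg_left (log_le_of_le_ofReal_exp h1)
        (by rw [← EReal.coe_zero, EReal.coe_le_coe_iff]; positivity)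
    rw [← EReal.coe_mul] at h2
    have h3 : (R i ^ 2)⁻¹ * -((c * R i / 4) ^ 2 / 16) = -(c ^ 2 / 256) := by
      field_simp
      norm_num
    rw [h3] at h2
    exact absurd hlog (not_lt.2 h2)
  have h4 := typeIIError_le hW hϰ hε b hy.le hti hD ha
  have h5 := ofReal_le_abs_of_le_neg (log_le_of_le_ofReal_exp h4)
  calc ENNReal.ofReal (R i ^ 2)
      = ENNReal.ofReal (256 / c ^ 2) * ENNReal.ofReal ((c * R i) ^ 2 / 256) := by
        rw [← ENNReal.ofReal_mul (by positivity)]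
        congr 1
        field_simp
    _ ≤ _ := mul_le_mul_right h5 _

theorem isLDConsistent_of_mem_besovBall (hW : IsGaussianWhiteNoise μ W) (hϰ : WeightConditions ϰ)
    (b : HilbertBasis ℕ ℝ L2) {r ω s q P : ℝ} (hq : q = 2 - 4 * r - 2 * ω) (hωq : 2 * ω < q)
    (hs : 0 < s) (hsq : q * s = r)
    (hk : (fun ε => (kEps ϰ ε : ℝ)) =Θ[𝓝[>] 0] (fun ε : ℝ => ε ^ (-(2 * q))))
    {S : ℝ → L2} (hS : ∀ᶠ ε in 𝓝[>] 0, S ε ∈ besovBall b s P)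
    (hnorm : (fun ε : ℝ => ε ^ (2 * r)) =O[𝓝[>] 0] fun ε => ‖S ε‖) :
    IsLDConsistent μ W b ϰ (𝓝[>] 0) (fun ε : ℝ => ε) S (fun ε : ℝ => ε ^ (-(2 * ω))) := by
  obtain ⟨M, hM, hMb⟩ := hnorm.exists_pos
  obtain ⟨K, hK, hKb⟩ := exists_le_kEps hk
  obtain ⟨K₁, hK₁, hK₁b⟩ := hϰ.exists_weightNorm_le hk
  obtain ⟨K₂, hK₂, hK₂b⟩ := hϰ.exists_weight_zero_le_weightNorm hk
  -- Since ‖S_ε‖² ≥ M⁻²ε^(4r), this makes the tail beyond a·k_ε at most half of that lower bound;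
  -- the other half sits where A4 bounds the weights below.
  obtain ⟨a, ha1, haP⟩ : ∃ a : ℝ, 1 < a ∧ P * (K ^ (2 * s) * a ^ (-(2 * s))) ≤ (M ^ 2)⁻¹ / 2 := by
    have hlim : Tendsto (fun a : ℝ => P * (K ^ (2 * s) * a ^ (-(2 * s)))) atTop
        (𝓝 (P * (K ^ (2 * s) * 0))) :=
      ((tendsto_rpow_neg_atTop (by linarith)).const_mul _).const_mul _
    rw [mul_zero, mul_zero] at hlim
    obtain ⟨a, h1, h2⟩ := ((hlim.eventually (gt_mem_nhds
      (show 0 < (M ^ 2)⁻¹ / 2 by positivity))).and (eventually_gt_atTop 1)).exists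
    exact ⟨a, h2, h1.le⟩
  obtain ⟨C, hC, hCb⟩ := hϰ.exists_le_weight ha1
  set c := C / K₁ * ((M ^ 2)⁻¹ / 2) with hcdef
  have hc : 0 < c := by positivity
  have hpos : ∀ᶠ ε : ℝ in 𝓝[>] 0, 0 < ε := self_mem_nhdsWithin
  refine isLDConsistent_of_le_drift hW hϰ b hpos ?_ hc ?_ ?_
  · filter_upwards [hpos] with ε hε
    positivity
  · filter_upwards [hpos, hS, hMb.bound, hKb, hK₁b] with ε hε hS hM' hK' hK₁'
    have hone : ∀ i : ℕ, (fun _ => 1 : ℕ → ℝ) i ≠ 0 := fun _ => one_ne_zero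
    have hkpos : (0 : ℝ) < kEps ϰ ε := Nat.cast_pos.2 (hϰ.kEps_pos hε)
    set i := ⌊a * (kEps ϰ ε : ℝ)⌋₊ with hi
    set res := greedyResidual (fun i => (fun _ => 1 : ℕ → ℝ) i • b i) (S ε) i with hres
    rw [Real.norm_of_nonneg (by positivity), norm_norm] at hM'
    have hp4 : (ε ^ (2 * r)) ^ 2 = ε ^ (4 * r) := by
      rw [← Real.rpow_natCast, ← Real.rpow_mul hε.le]
      congr 1
      push_cast
      ring
    have hSn : (M ^ 2)⁻¹ * ε ^ (4 * r) ≤ ‖S ε‖ ^ 2 := by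
      rw [inv_mul_le_iff₀ (by positivity), ← mul_pow, ← hp4]
      exact pow_le_pow_left₀ (by positivity) hM' 2
    have hresn : ‖res‖ ^ 2 ≤ (M ^ 2)⁻¹ / 2 * ε ^ (4 * r) := by
      have h1 := (mem_besovBall_iff b hone hs).1 hS i
      rw [← hres] at h1
      have h2 : (a * K⁻¹ * ε ^ (-(2 * q))) ^ (2 * s) ≤ ((i : ℝ) + 1) ^ (2 * s) := by
        refine Real.rpow_le_rpow (by positivity) ?_ (by linarith)
        calc a * K⁻¹ * ε ^ (-(2 * q)) ≤ a * K⁻¹ * (K * kEps ϰ ε) := by gcongr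
          _ = a * kEps ϰ ε := by field_simp
          _ ≤ _ := (Nat.lt_floor_add_one _).le
      have h3 : (a * K⁻¹ * ε ^ (-(2 * q))) ^ (2 * s) =
          (K ^ (2 * s) * a ^ (-(2 * s)) * ε ^ (4 * r))⁻¹ := by
        rw [Real.mul_rpow (by positivity) (by positivity),
          Real.mul_rpow (by positivity) (by positivity), Real.inv_rpow hK.le,
          ← Real.rpow_mul hε.le, Real.rpow_neg (by positivity), mul_inv, mul_inv, inv_inv,
          show -(2 * q) * (2 * s) = -(4 * r) by rw [← hsq]; ring, Real.rpow_neg hε.le]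
        ring
      rw [h3] at h2
      have h4 := (mul_le_mul_of_nonneg_right h2 (sq_nonneg ‖res‖)).trans h1
      rw [inv_mul_le_iff₀ (by positivity)] at h4
      calc ‖res‖ ^ 2 ≤ _ := h4
        _ = P * (K ^ (2 * s) * a ^ (-(2 * s))) * ε ^ (4 * r) := by ring
        _ ≤ _ := by gcongr
    have hd := hϰ.le_drift hε b hone (S ε) (i := i) (A := C * kappaSq ϰ ε) fun j hj => by
      refine hCb ε hε j ?_
      have h1 : j + 1 ≤ i := hj
      have h2 : ((j + 1 : ℕ) : ℝ) ≤ a * kEps ϰ ε :=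
        (Nat.cast_le.2 h1).trans (Nat.floor_le (by positivity))
      push_cast at h2
      exact h2
    refine le_trans ?_ hd
    have hκ := kappaSq_nonneg ϰ ε
    have hdiff : (M ^ 2)⁻¹ / 2 * ε ^ (4 * r) ≤ ‖S ε‖ ^ 2 - ‖res‖ ^ 2 := by linarith
    have hexp : ε ^ (4 * r) = ε ^ (-(2 * ω)) * ε ^ 2 / ε ^ q := by
      rw [eq_div_iff (by positivity), ← Real.rpow_natCast ε 2, ← Real.rpow_add hε,
        ← Real.rpow_add hε]
      congr 1
      push_cast
      rw [hq]
      ring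
    calc c * ε ^ (-(2 * ω)) * weightNorm ϰ ε
        = C / ε ^ 2 * ((M ^ 2)⁻¹ / 2 * ε ^ (4 * r)) * (ε ^ q * weightNorm ϰ ε / K₁) := by
          rw [hcdef, hexp]
          field_simp
      _ ≤ C / ε ^ 2 * ((M ^ 2)⁻¹ / 2 * ε ^ (4 * r)) * kappaSq ϰ ε := by
          gcongr
          rw [div_le_iff₀ hK₁, mul_comm]
          linarith
      _ = C * kappaSq ϰ ε / ε ^ 2 * ((M ^ 2)⁻¹ / 2 * ε ^ (4 * r)) := by ring
      _ ≤ _ := by gcongr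
  -- R·a_1/σ is O(ε^(q-2ω)), so 2ω < q keeps the rate within the Gaussian range of deviations.
  · have hlim : Tendsto (fun ε : ℝ => c * K₂ * ε ^ (q - 2 * ω)) (𝓝[>] 0) (𝓝 (c * K₂ * 0)) :=
      (tendsto_rpow_nhdsGT_zero (by linarith)).const_mul _
    rw [mul_zero] at hlim
    filter_upwards [hpos, hK₂b, hlim.eventually (gt_mem_nhds one_pos)] with ε hε h1 h2
    have hσ := hϰ.weightNorm_pos hε
    calc c * ε ^ (-(2 * ω)) * weight ϰ ε 0
        ≤ c * ε ^ (-(2 * ω)) * (K₂ * ε ^ q * weightNorm ϰ ε) := by gcongr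
      _ = c * K₂ * ε ^ (q - 2 * ω) * weightNorm ϰ ε := by
          rw [sub_eq_add_neg, Real.rpow_add hε]
          ring
      _ ≤ 1 * weightNorm ϰ ε := by gcongr
      _ = _ := one_mul _

end Consistency

/-! ### Property (ii): inconsistency outside the space. -/

section Inconsistency

variable {Ω : Type*} [MeasurableSpace Ω] {μ : Measure Ω} {W : L2 → Ω → ℝ} {ϰ : ℝ → ℕ → ℝ}

/-- Alternatives whose drift is negligible with respect to `R σ_ε` are LD inconsistent. -/
theorem not_isLDConsistent_of_drift (hW : IsGaussianWhiteNoise μ W) (hϰ : WeightConditions ϰ)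
    (b : HilbertBasis ℕ ℝ L2) {ι : Type*} {l : Filter ι} [l.NeBot] {ε : ι → ℝ} {S : ι → L2}
    {R : ι → ℝ} (hε : ∀ᶠ i in l, 0 < ε i) (hR : Tendsto R l atTop)
    (hD : Tendsto (fun i => drift b ϰ (ε i) (S i) / weightNorm ϰ (ε i) / R i) l (𝓝 0))
    (ha : Tendsto (fun i => R i * weight ϰ (ε i) 0 / weightNorm ϰ (ε i)) l (𝓝 0)) :
    ¬ IsLDConsistent μ W b ϰ l ε S R := by
  have : IsProbabilityMeasure μ := (hW.iIndepFun_basis b).isProbabilityMeasure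
  -- The threshold of `le_typeIIError`: it is o(R), so log α ≥ -56T² - log 4 is o(R²), and still β ≥
  -- 1/2.
  set T : ι → ℝ := fun i => 2 * (drift b ϰ (ε i) (S i) / weightNorm ϰ (ε i)) + 5 with hT
  have hRpos : ∀ᶠ i in l, 0 < R i := hR.eventually_gt_atTop 0
  have hRinv : Tendsto (fun i => (R i)⁻¹) l (𝓝 0) := tendsto_inv_atTop_zero.comp hR
  have hTR : Tendsto (fun i => T i * (R i)⁻¹) l (𝓝 0) := by
    have h := (hD.const_mul 2).add (hRinv.const_mul 5)
    simp only [mul_zero, add_zero] at h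
    refine h.congr fun i => ?_
    simp only [hT]
    ring
  have hTa : ∀ᶠ i in l, 16 * T i * weight ϰ (ε i) 0 ≤ weightNorm ϰ (ε i) := by
    have h := (hTR.mul ha).const_mul 16
    simp only [mul_zero] at h
    filter_upwards [hε, hRpos, h.eventually (gt_mem_nhds one_pos)] with i hε hR h1
    have hσ := hϰ.weightNorm_pos hε
    have h2 : 16 * (T i * (R i)⁻¹ * (R i * weight ϰ (ε i) 0 / weightNorm ϰ (ε i))) =
        16 * T i * weight ϰ (ε i) 0 / weightNorm ϰ (ε i) := by field_simp
    rw [h2, div_lt_one hσ] at h1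
    exact h1.le
  have hT5 : ∀ i, 5 ≤ T i := fun i => by
    have : 0 ≤ drift b ϰ (ε i) (S i) / weightNorm ϰ (ε i) :=
      div_nonneg (drift_nonneg _ _ _ _) (Real.sqrt_nonneg _)
    simp only [hT]
    linarith
  intro hcons
  obtain ⟨C, hC, hCb⟩ := hcons (fun i => T i * ε i ^ 2) (by
    have hlow : Tendsto (fun i => (((R i ^ 2)⁻¹ * (-(56 * T i ^ 2) - Real.log 4) : ℝ) : EReal)) l
        (𝓝 0) := by
      rw [← EReal.coe_zero]
      refine (continuous_coe_real_ereal.tendsto 0).comp ?_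
      have h := ((hTR.pow 2).const_mul (-56)).add ((hRinv.pow 2).const_mul (-Real.log 4))
      norm_num at h
      refine h.congr fun i => ?_
      ring
    refine tendsto_of_tendsto_of_tendsto_of_le_of_le' hlow tendsto_const_nhds ?_ ?_
    · filter_upwards [hε, hTa] with i hε hTa
      have h1 := ENNReal.log_le_log (le_typeIError hW hϰ hε b (by linarith [hT5 i]) hTa)
      rw [ENNReal.log_ofReal_of_pos (by positivity),
        Real.log_div (Real.exp_pos _).ne' (by norm_num), Real.log_exp] at h1
      rw [EReal.coe_mul]
      exact mul_le_mul_of_nonneg_left h1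
        (by rw [← EReal.coe_zero, EReal.coe_le_coe_iff]; positivity)
    · refine Eventually.of_forall fun i => ?_
      refine mul_nonpos_of_nonneg_of_nonpos
        (by rw [← EReal.coe_zero, EReal.coe_le_coe_iff]; positivity) ?_
      exact ENNReal.log_le_zero_iff.2 prob_le_one)
  have hbig : ∀ᶠ i in l, C * Real.log 2 < R i ^ 2 :=
    ((tendsto_pow_atTop two_ne_zero).comp hR).eventually_gt_atTop _
  obtain ⟨i, hε, hTa, hCb, hbig⟩ := (hε.and (hTa.and (hCb.and hbig))).exists
  have h1 := le_typeIIError hW hϰ hε b (S := S i) (t := T i) rfl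
    (le_trans (by nlinarith [hT5 i, weight_nonneg ϰ (ε i) 0]) hTa)
  set β := typeIIError μ W b ϰ (ε i) (T i * ε i ^ 2) (S i)
  have hβ1 : β ≤ 1 := prob_le_one
  have h2 : (ENNReal.log β).abs ≤ ENNReal.ofReal (Real.log 2) := by
    have hβ0 : β ≠ 0 := (lt_of_lt_of_le (ENNReal.ofReal_pos.2 (by norm_num)) h1).ne'
    have hβt : β ≠ ⊤ := (hβ1.trans_lt ENNReal.one_lt_top).ne
    rw [ENNReal.log_pos_real hβ0 hβt, EReal.abs_def]
    apply ENNReal.ofReal_le_ofReal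
    have hr1 : β.toReal ≤ 1 := by simpa using ENNReal.toReal_mono ENNReal.one_ne_top hβ1
    have hr2 : 1 / 2 ≤ β.toReal := (ENNReal.ofReal_le_iff_le_toReal hβt).1 h1
    rw [abs_of_nonpos (Real.log_nonpos (by linarith) hr1)]
    have := Real.log_le_log (by norm_num) hr2
    rw [one_div, Real.log_inv] at this
    linarith
  have h3 : ENNReal.ofReal (R i ^ 2) ≤ ENNReal.ofReal (C * Real.log 2) := by
    rw [ENNReal.ofReal_mul hC.le]
    exact hCb.trans (mul_le_mul_right h2 _)
  rw [ENNReal.ofReal_le_ofReal_iff (by positivity)] at h3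
  linarith

/-- Residuals of norm `O(ε^{2r})` that start far beyond `k_ε` are LD inconsistent. -/
theorem not_isLDConsistent_greedyResidual (hW : IsGaussianWhiteNoise μ W)
    (hϰ : WeightConditions ϰ) (b : HilbertBasis ℕ ℝ L2) {r ω s q : ℝ}
    (hq : q = 2 - 4 * r - 2 * ω) (hω : 0 < ω) (hωq : 2 * ω < q) (hs : 0 < s) (hsq : q * s = r)
    (hk : (fun ε => (kEps ϰ ε : ℝ)) =Θ[𝓝[>] 0] (fun ε : ℝ => ε ^ (-(2 * q))))
    {c : ℕ → ℝ} (hc : ∀ i, c i ≠ 0) (S : L2) {i : ℕ → ℕ} {ε : ℕ → ℝ}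
    (hε : Tendsto ε atTop (𝓝[>] 0)) {M : ℝ} (hM : 0 < M)
    (hnorm : ∀ n, ‖greedyResidual (fun i => c i • b i) S (i n)‖ ≤ M * ε n ^ (2 * r))
    (hi : Tendsto (fun n => ((i n : ℝ) + 1) ^ s *
      ‖greedyResidual (fun i => c i • b i) S (i n)‖) atTop atTop) :
    ¬ IsLDConsistent μ W b ϰ atTop ε (fun n => greedyResidual (fun i => c i • b i) S (i n))
      (fun n => ε n ^ (-(2 * ω))) := by
  have hεpos : ∀ᶠ n in atTop, 0 < ε n := hε.eventually self_mem_nhdsWithin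
  obtain ⟨K, hK, hKb⟩ := exists_kEps_le hk
  obtain ⟨K₁, hK₁, hK₁b⟩ := hϰ.exists_kappaSq_le hk
  obtain ⟨K₂, hK₂, hK₂b⟩ := hϰ.exists_weight_zero_le_weightNorm hk
  obtain ⟨C, hC, lam, hlam, hCb⟩ := hϰ.exists_weight_le
  set x : ℕ → ℝ := fun n => ((i n : ℝ) + 1) / kEps ϰ (ε n) with hx
  have hx0 : ∀ n, 0 ≤ x n := fun n => by positivity
  -- Here k_ε^s ≲ ε^(-2r) while the residual norm is at most Mε^(2r), so x^s is at least a constant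
  -- times (i+1)^s‖S̃_i‖.
  have hxs : Tendsto (fun n => x n ^ s) atTop atTop := by
    refine tendsto_atTop_mono' _ ?_
      (hi.const_mul_atTop (inv_pos.2 (mul_pos hM (Real.rpow_pos_of_pos hK s))))
    filter_upwards [hεpos, hε.eventually hKb] with n hε hK'
    have hkpos : (0 : ℝ) < kEps ϰ (ε n) := Nat.cast_pos.2 (hϰ.kEps_pos hε)
    simp only [hx]
    rw [Real.div_rpow (by positivity) hkpos.le, le_div_iff₀ (by positivity)]
    have h1 : (kEps ϰ (ε n) : ℝ) ^ s ≤ K ^ s * ε n ^ (-(2 * r)) := by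
      refine (Real.rpow_le_rpow hkpos.le hK' hs.le).trans_eq ?_
      rw [Real.mul_rpow hK.le (by positivity), ← Real.rpow_mul hε.le]
      congr 2
      rw [← hsq]
      ring
    have h2 : ε n ^ (2 * r) * ε n ^ (-(2 * r)) = 1 := by
      rw [← Real.rpow_add hε, add_neg_cancel, Real.rpow_zero]
    set m := ‖greedyResidual (fun i => c i • b i) S (i n)‖
    calc (M * K ^ s)⁻¹ * (((i n : ℝ) + 1) ^ s * m) * (kEps ϰ (ε n) : ℝ) ^ s
        ≤ (M * K ^ s)⁻¹ * (((i n : ℝ) + 1) ^ s * (M * ε n ^ (2 * r))) *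
            (K ^ s * ε n ^ (-(2 * r))) := by
          have := hnorm n
          gcongr
      _ = ((i n : ℝ) + 1) ^ s * (ε n ^ (2 * r) * ε n ^ (-(2 * r))) *
            ((M * K ^ s)⁻¹ * (M * K ^ s)) := by ring
      _ = _ := by rw [h2, inv_mul_cancel₀ (by positivity), mul_one, mul_one]
  have hxlam : Tendsto (fun n => x n ^ (-lam)) atTop (𝓝 0) := by
    refine ((tendsto_rpow_neg_atTop (div_pos hlam hs)).comp hxs).congr fun n => ?_
    rw [Function.comp_apply, ← Real.rpow_mul (hx0 n)]
    congr 1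
    field_simp
  refine not_isLDConsistent_of_drift hW hϰ b hεpos ?_ ?_ ?_
  · exact (tendsto_rpow_neg_nhdsGT_zero (by linarith)).comp hε
  · have hlim := hxlam.const_mul (C * K₁ * M ^ 2)
    rw [mul_zero] at hlim
    refine squeeze_zero' ?_ ?_ hlim
    · filter_upwards [hεpos] with n hε
      have := hϰ.weightNorm_pos hε
      have := drift_nonneg b ϰ (ε n) (greedyResidual (fun i => c i • b i) S (i n))
      positivity
    · filter_upwards [hεpos, hε.eventually hK₁b, hxs.eventually_gt_atTop (2 ^ s)]
        with n hε hκ h2s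
      have hkpos : (0 : ℝ) < kEps ϰ (ε n) := Nat.cast_pos.2 (hϰ.kEps_pos hε)
      have hσ := hϰ.weightNorm_pos hε
      have hik : kEps ϰ (ε n) ≤ i n := by
        have h3 : 2 < x n := (Real.rpow_lt_rpow_iff (by norm_num) (hx0 n) hs).1 h2s
        simp only [hx] at h3
        rw [lt_div_iff₀ hkpos] at h3
        have h4 : ((2 * kEps ϰ (ε n) : ℕ) : ℝ) < ((i n + 1 : ℕ) : ℝ) := by push_cast; exact h3
        have := Nat.cast_lt.1 h4
        have := hϰ.kEps_pos hε
        omega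
      have hw := hCb (ε n) hε (i n) hik
      have hdr := hϰ.drift_greedyResidual_le hε b hc S (i n)
      set D := drift b ϰ (ε n) (greedyResidual (fun i => c i • b i) S (i n))
      rw [div_div, div_le_iff₀ (by positivity)]
      have hm2 : ‖greedyResidual (fun i => c i • b i) S (i n)‖ ^ 2 ≤ (M * ε n ^ (2 * r)) ^ 2 :=
        pow_le_pow_left₀ (norm_nonneg _) (hnorm n) 2
      have hw0 := weight_nonneg ϰ (ε n) (i n)
      have hxl : 0 ≤ x n ^ (-lam) := Real.rpow_nonneg (hx0 n) _
      have hexp : (ε n ^ (2 * r)) ^ 2 * ε n ^ q / ε n ^ 2 = ε n ^ (-(2 * ω)) := by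
        rw [div_eq_iff (by positivity), ← Real.rpow_natCast (ε n ^ (2 * r)) 2,
          ← Real.rpow_natCast (ε n) 2, ← Real.rpow_mul hε.le, ← Real.rpow_add hε,
          ← Real.rpow_add hε]
        congr 1
        push_cast
        rw [hq]
        ring
      calc D ≤ _ := hdr
        _ ≤ weight ϰ (ε n) (i n) / ε n ^ 2 * (M * ε n ^ (2 * r)) ^ 2 := by gcongr
        _ ≤ (C * x n ^ (-lam) * kappaSq ϰ (ε n)) / ε n ^ 2 * (M * ε n ^ (2 * r)) ^ 2 := by gcongr
        _ ≤ (C * x n ^ (-lam) * (K₁ * ε n ^ q * weightNorm ϰ (ε n))) / ε n ^ 2 *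
              (M * ε n ^ (2 * r)) ^ 2 := by gcongr
        _ = C * K₁ * M ^ 2 * x n ^ (-lam) * weightNorm ϰ (ε n) *
              ((ε n ^ (2 * r)) ^ 2 * ε n ^ q / ε n ^ 2) := by ring
        _ = _ := by rw [hexp]; ring
  · have hlim : Tendsto (fun n => K₂ * ε n ^ (q - 2 * ω)) atTop (𝓝 (K₂ * 0)) :=
      ((tendsto_rpow_nhdsGT_zero (by linarith)).comp hε).const_mul _
    rw [mul_zero] at hlim
    refine squeeze_zero' ?_ ?_ hlim
    · filter_upwards [hεpos] with n hε
      have := hϰ.weightNorm_pos hε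
      have := weight_nonneg ϰ (ε n) 0
      positivity
    · filter_upwards [hεpos, hε.eventually hK₂b] with n hε h1
      have hσ := hϰ.weightNorm_pos hε
      rw [div_le_iff₀ hσ]
      calc ε n ^ (-(2 * ω)) * weight ϰ (ε n) 0
          ≤ ε n ^ (-(2 * ω)) * (K₂ * ε n ^ q * weightNorm ϰ (ε n)) := by gcongr
        _ = K₂ * ε n ^ (q - 2 * ω) * weightNorm ϰ (ε n) := by
            rw [sub_eq_add_neg, Real.rpow_add hε]
            ring

theorem tendsto_norm_greedyResidual (b : HilbertBasis ℕ ℝ L2) {c : ℕ → ℝ} (hc : ∀ i, c i ≠ 0)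
    (S : L2) : Tendsto (fun i => ‖greedyResidual (fun i => c i • b i) S i‖) atTop (𝓝 0) := by
  have hsq : ∀ i, ‖greedyResidual (fun i => c i • b i) S i‖ ^ 2 =
      ‖S‖ ^ 2 - ∑ j ∈ Finset.range i, (inner ℝ (b j) S : ℝ) ^ 2 := by
    intro i
    have h1 := (hasSum_inner_sq b S).sub (hasSum_greedyResidual b hc S i)
    have h2 := hasSum_sum_of_ne_finset_zero (L := SummationFilter.unconditional ℕ)
      (s := Finset.range i)
      (f := fun j => (inner ℝ (b j) S : ℝ) ^ 2 - if i ≤ j then (inner ℝ (b j) S : ℝ) ^ 2 else 0)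
      fun j hj => by
        rw [if_pos (by simpa using hj), sub_self]
    have h3 := h1.unique h2
    have h4 : ∑ j ∈ Finset.range i, ((inner ℝ (b j) S : ℝ) ^ 2 -
        if i ≤ j then (inner ℝ (b j) S : ℝ) ^ 2 else 0) =
        ∑ j ∈ Finset.range i, (inner ℝ (b j) S : ℝ) ^ 2 :=
      Finset.sum_congr rfl fun j hj => by
        rw [if_neg (by simpa using hj), sub_zero]
    linarith
  have h5 := (hasSum_inner_sq b S).tendsto_sum_nat.const_sub (‖S‖ ^ 2)
  rw [sub_self] at h5
  have h6 := (h5.congr fun i => (hsq i).symm).sqrt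
  simpa using h6

/-- If `S` is not in the Besov space, then `i^s ‖S̃_i‖` is unbounded, along large `i`. -/
theorem exists_large_greedyResidual (b : HilbertBasis ℕ ℝ L2) {c : ℕ → ℝ} (hc : ∀ i, c i ≠ 0)
    {s : ℝ} (hs : 0 < s) {S : L2} (hS : S ∉ besovSpace b s) (n : ℕ) :
    ∃ i ≥ n, ‖greedyResidual (fun i => c i • b i) S i‖ ≤ 1 ∧
      (n : ℝ) < ((i : ℝ) + 1) ^ s * ‖greedyResidual (fun i => c i • b i) S i‖ := by
  obtain ⟨N, hN⟩ := eventually_atTop.1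
    ((tendsto_norm_greedyResidual b hc S).eventually (gt_mem_nhds one_pos))
  set f : ℕ → ℝ := fun i => ((i : ℝ) + 1) ^ s * ‖greedyResidual (fun i => c i • b i) S i‖ with hf
  have hf0 : ∀ i, 0 ≤ f i := fun i => by positivity
  by_contra hcon
  push Not at hcon
  -- The negation bounds `f` by `n` from max n N on; the finitely many earlier values are bounded by
  -- their sum. So `S` would lie in the space.
  have hbd : ∀ i, f i ≤ n + ∑ j ∈ Finset.range (max n N), f j := by
    intro i
    by_cases hi : i < max n N
    · have := Finset.single_le_sum (f := f) (fun j _ => hf0 j) (Finset.mem_range.2 hi)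
      have hn : (0 : ℝ) ≤ n := Nat.cast_nonneg n
      linarith
    · have hi' := max_le_iff.1 (not_lt.1 hi)
      have := hcon i hi'.1 (hN i hi'.2).le
      have h0 : 0 ≤ ∑ j ∈ Finset.range (max n N), f j := Finset.sum_nonneg fun j _ => hf0 j
      linarith
  refine hS ⟨(n + ∑ j ∈ Finset.range (max n N), f j) ^ 2, (mem_besovBall_iff b hc hs).2 fun i => ?_⟩
  have hi : (0 : ℝ) < (i : ℝ) + 1 := by positivity
  rw [two_mul, Real.rpow_add hi, ← sq, ← mul_pow]
  exact pow_le_pow_left₀ (hf0 i) (hbd i) 2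

theorem exists_not_isLDConsistent (hW : IsGaussianWhiteNoise μ W)
    (hϰ : WeightConditions ϰ) (b : HilbertBasis ℕ ℝ L2) {r ω s q : ℝ} (hr : 0 < r)
    (hq : q = 2 - 4 * r - 2 * ω) (hω : 0 < ω) (hωq : 2 * ω < q) (hs : 0 < s) (hsq : q * s = r)
    (hk : (fun ε => (kEps ϰ ε : ℝ)) =Θ[𝓝[>] 0] (fun ε : ℝ => ε ^ (-(2 * q))))
    {c : ℕ → ℝ} (hc : ∀ i, c i ≠ 0) {S : L2} (hS : S ∉ besovSpace b s) :
    ∃ i j : ℕ → ℕ, Tendsto i atTop atTop ∧ Tendsto j atTop atTop ∧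
      (∃ c₁ > 0, ∃ C > 0, ∀ n,
        c₁ * (j n : ℝ) ^ (-r) < ‖greedyResidual (fun i => c i • b i) S (i n)‖ ∧
        ‖greedyResidual (fun i => c i • b i) S (i n)‖ < C * (j n : ℝ) ^ (-r)) ∧
      ¬ IsLDConsistent μ W b ϰ atTop (fun n => (j n : ℝ) ^ (-(1 / 2 : ℝ)))
        (fun n => greedyResidual (fun i => c i • b i) S (i n)) (fun n => (j n : ℝ) ^ ω) := by
  choose i hin hi1 hi2 using exists_large_greedyResidual b hc hs hS
  set m : ℕ → ℝ := fun n => ‖greedyResidual (fun i => c i • b i) S (i n)‖ with hm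
  have hi : Tendsto i atTop atTop := tendsto_atTop_mono hin tendsto_id
  have hmpos : ∀ n, 0 < m n := fun n =>
    pos_of_mul_pos_right ((Nat.cast_nonneg n).trans_lt (hi2 n)) (by positivity)
  have hm0 : Tendsto m atTop (𝓝 0) := (tendsto_norm_greedyResidual b hc S).comp hi
  -- Solves j^(-r) ≍ ‖S̃_i‖ in integers. As the norm is at most 1, the argument is at least 1 and
  -- the ceiling at most doubles it; hence the factor 2^r below.
  set j : ℕ → ℕ := fun n => ⌈m n ^ (-r⁻¹)⌉₊ with hj
  have hle : ∀ n, m n ^ (-r⁻¹) ≤ j n := fun n => Nat.le_ceil _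
  have hone : ∀ n, 1 ≤ m n ^ (-r⁻¹) := fun n =>
    Real.one_le_rpow_of_pos_of_le_one_of_nonpos (hmpos n) (hi1 n) (by simpa using hr.le)
  have hjpos : ∀ n, (0 : ℝ) < j n := fun n => lt_of_lt_of_le one_pos ((hone n).trans (hle n))
  have hlt : ∀ n, (j n : ℝ) ≤ 2 * m n ^ (-r⁻¹) := fun n => by
    have := Nat.ceil_lt_add_one (zero_le_one.trans (hone n))
    have h1 := hone n
    simp only [hj]
    linarith
  have hback : ∀ n, (m n ^ (-r⁻¹)) ^ (-r) = m n := fun n => by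
    rw [← Real.rpow_mul (hmpos n).le, neg_mul_neg, inv_mul_cancel₀ hr.ne', Real.rpow_one]
  have hlow : ∀ n, (j n : ℝ) ^ (-r) ≤ m n := fun n => by
    rw [← hback n]
    exact Real.rpow_le_rpow_of_nonpos (by linarith [hone n]) (hle n) (by linarith)
  have hup : ∀ n, m n ≤ 2 ^ r * (j n : ℝ) ^ (-r) := fun n => by
    have h1 := Real.rpow_le_rpow_of_nonpos (hjpos n) (hlt n) (show -r ≤ 0 by linarith)
    rw [Real.mul_rpow (by norm_num) (by linarith [hone n]), hback n, Real.rpow_neg (by norm_num),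
      inv_mul_le_iff₀ (by positivity)] at h1
    exact h1
  have hjt : Tendsto (fun n => (j n : ℝ)) atTop atTop := by
    refine tendsto_atTop_mono hle ?_
    refine (tendsto_rpow_neg_nhdsGT_zero (by simpa using hr)).comp
      (tendsto_nhdsWithin_iff.2 ⟨hm0, Eventually.of_forall hmpos⟩)
  refine ⟨i, j, hi, tendsto_natCast_atTop_iff.1 hjt,
    ⟨1 / 2, by norm_num, 2 ^ r + 1, by positivity, fun n => ⟨?_, ?_⟩⟩, ?_⟩
  · have h1 : 0 < (j n : ℝ) ^ (-r) := Real.rpow_pos_of_pos (hjpos n) _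
    have h2 := hlow n
    change _ < m n
    linarith
  · have h1 : 0 < (j n : ℝ) ^ (-r) := Real.rpow_pos_of_pos (hjpos n) _
    have h2 := hup n
    change m n < _
    linarith
  · have hR : (fun n => (j n : ℝ) ^ ω) = fun n => ((j n : ℝ) ^ (-(1 / 2 : ℝ))) ^ (-(2 * ω)) := by
      funext n
      rw [← Real.rpow_mul (hjpos n).le]
      congr 1
      ring
    rw [hR]
    refine not_isLDConsistent_greedyResidual hW hϰ b hq hω hωq hs hsq hk hc S
      (tendsto_nhdsWithin_iff.2 ⟨(tendsto_rpow_neg_atTop (by norm_num)).comp hjt,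
        Eventually.of_forall fun n => Real.rpow_pos_of_pos (hjpos n) _⟩)
      (M := 2 ^ r) (by positivity) (fun n => ?_) ?_
    · refine (hup n).trans_eq ?_
      rw [← Real.rpow_mul (hjpos n).le]
      congr 2
      ring
    · exact tendsto_atTop_mono (fun n => (hi2 n).le) tendsto_natCast_atTop_atTop

end Inconsistency

end SignalDetection

end

/-! ### Assembly of the maxiset properties. -/

theorem mainTheorem1 {Ω : Type*} [MeasurableSpace Ω] (μ : Measure Ω)
    (W : SignalDetection.L2 → Ω → ℝ) (hW : SignalDetection.IsGaussianWhiteNoise μ W)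
    (b : HilbertBasis ℕ ℝ SignalDetection.L2) (ϰ : ℝ → ℕ → ℝ)
    (hϰ : SignalDetection.WeightConditions ϰ)
    (r ω s : ℝ) (hr : 0 < r) (hr' : r < 1 / 2) (hω : 0 < 2 * ω) (hω' : 2 * ω < 1 - 2 * r)
    (hk : (fun ε => (SignalDetection.kEps ϰ ε : ℝ)) =Θ[𝓝[>] 0]
      (fun ε : ℝ => ε ^ (-4 + 8 * r + 4 * ω)))
    (hs : s = r / (2 - 4 * r - 2 * ω)) (P₀ : ℝ) (hP₀ : 0 < P₀) :
    SignalDetection.IsMaxiset μ W b ϰ r ω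
      (SignalDetection.besovBall b s P₀) (SignalDetection.besovSpace b s)
      (fun i => (√P₀ * ((i : ℝ) + 1) ^ (-s)) • b i) := by
  obtain ⟨q, hq⟩ : ∃ q, q = 2 - 4 * r - 2 * ω := ⟨_, rfl⟩
  rw [← hq] at hs
  -- q - 2ω = 2(1 - 2r - 2ω), positive by the assumption on ω.
  have hωq : 2 * ω < q := by linarith
  have hq0 : 0 < q := by linarith
  have hs0 : 0 < s := hs ▸ div_pos hr hq0
  have hsq : q * s = r := by rw [hs]; field_simp
  rw [show -4 + 8 * r + 4 * ω = -(2 * q) by rw [hq]; ring] at hk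
  exact
    { convex := SignalDetection.convex_besovBall b hs0 hP₀.le
      symmetric := fun _ hS => SignalDetection.neg_mem_besovBall b hS
      compact := SignalDetection.isCompact_besovBall b hs0 hP₀.le
      span_eq := SignalDetection.span_besovBall b hs0 hP₀
      greedy := SignalDetection.isGreedySystem_besovBall b hs0 hP₀
      consistent := fun _ hS hnorm =>
        SignalDetection.isLDConsistent_of_mem_besovBall hW hϰ b hq hωq hs0 hsq hk hS hnorm.2
      inconsistent := fun _ hS =>
        SignalDetection.exists_not_isLDConsistent hW hϰ b hr hq (by linarith) hωq hs0 hsq hk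
          (SignalDetection.besov_coeff_ne_zero hP₀) hS }
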